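/- Fix an integer $n\ge 1$. Let $\widehat{\mathcal T}$ be the set of all sequences ${\bf k}=(k_1,k_2,\dots)$ of positive integers, and let $\widehat{\mathcal T}^R\subset\widehat{\mathcal T}$ be the set of those for which there is an $s$ with $k_s\ge 2$ and $k_i=1$ for all $i>s$. The map $\tau({\bf k})=\sum_{r\ge1}2^{-(k_1+\cdots+k_r)}$ is a bijection from $\widehat{\mathcal T}$ onto $(0,1]$, and $\tau(\widehat{\mathcal T}^R)=\{x\in(0,1) : 2^lx\in\mathbb N\text{ for some }l\in\mathbb N\}$. Put $$T_n(k_1,\dots,k_r)=\int_{[0,1]^{k_1+\cdots+k_r}}\ \prod_{i=1}^r\ \sum_{j=0}^n (x_1x_2\cdots x_{k_1+\cdots+k_i})^j\ dx_1\cdots dx_{k_1+\cdots+k_r}.$$ For every ${\bf k}\in\widehat{\mathcal T}$ the limit $\eta_n({\bf k})=\lim_{r\to\infty}T_n(k_1,\dots,k_r)$ exists and lies in $(1,+\infty)$. Let $F_n=\eta_n\circ\tau^{-1}:(0,1]\to(1,+\infty)$. Then $F_n$ is of bounded variation, and there are strictly increasing functions $G_n,H_n:(0,1]\to(1,+\infty)$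 with $F_n=G_n-H_n$ such that: (a) $G_n$ is continuous on $(0,1]$; (b) $H_n$ is discontinuous at every point of $\tau(\widehat{\mathcal T}^R)$ and continuous at every point of $\tau(\widehat{\mathcal T}\setminus\widehat{\mathcal T}^R)$; moreover it is a jump function, i.e. there are a constant $c$ and positive numbers $h(y)$, $y\in\tau(\widehat{\mathcal T}^R)$, with finite sum, such that $H_n(x)=c+\sum_{y\in\tau(\widehat{\mathcal T}^R),\,y<x}h(y)$ for all $x\in(0,1]$; (c) the image $\mathrm{Im}(H_n)=H_n((0,1])$ is bi-Lipschitz equivalent to $C\setminus C^b$, where $C$ is the set of all $x=\sum_{i\ge1}a_i(n+2)^{-i}\in[0,1]$ with all $a_i\in\{0,n+1\}$ (the $(n+2)$-adic Cantor set) and $C^b\subset C$ is the countable set of all finite sums $\sum_{i=1}^r a_i(n+2)^{-i}$ with $a_i\in\{0,n+1\}$; (d) $\dim_{\mathrm H}\mathrm{Im}(H_n)=\dfrac{\log 2}{\log(n+2)}$, where $\dim_{\mathrm H}$ is the Hausdorff dimension. -/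

import Mathlib

open Set Filter Topology MeasureTheory

noncomputable section

namespace ZetaStarDeformation

/-- The sequences `(k₁, k₂, …)` of positive integers; the entry `k i` is the mathematical `k_{i+1}`. -/
abbrev PosSeq : Type := ℕ → ℕ+

/-- The sequences that have an entry `≥ 2` after which all the entries are `1`. -/
def SeqR : Set PosSeq := {k | ∃ s, 2 ≤ k s ∧ ∀ i, s < i → k i = 1}

/-- The partial sum `k₁ + ⋯ + k_r`. -/
def psum (k : PosSeq) (r : ℕ) : ℕ := ∑ i ∈ Finset.range r, (k i : ℕ)

/-- `τ(k) = ∑_{r ≥ 1} 2^{-(k₁ + ⋯ + k_r)}`. -/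
def tau (k : PosSeq) : ℝ := ∑' r : ℕ, 1 / (2 : ℝ) ^ psum k (r + 1)

/-- `T_n(k₁, …, k_r)`: the integral over the unit cube of dimension `k₁ + ⋯ + k_r` of
`∏_{i=1}^{r} (1 + X_i + ⋯ + X_i ^ n)`, where `X_i` is the product of the first
`k₁ + ⋯ + k_i` coordinates. -/
def T (n : ℕ) (k : PosSeq) (r : ℕ) : ℝ :=
  ∫ x in Set.Icc (0 : Fin (psum k r) → ℝ) 1,
    ∏ i ∈ Finset.range r, ∑ j ∈ Finset.range (n + 1),
      (∏ l : Fin (psum k r) with l.val < psum k (i + 1), x l) ^ j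

/-- `η_n(k) = lim_{r → ∞} T_n(k₁, …, k_r)`. -/
def eta (n : ℕ) (k : PosSeq) : ℝ := limUnder atTop (fun r => T n k r)

/-- `F_n = η_n ∘ τ⁻¹`; it is used on `(0, 1]`, the range of the injective map `τ`. -/
def F (n : ℕ) (x : ℝ) : ℝ := eta n (Function.invFun tau x)

/-- The `m`-adic Cantor set: the numbers in `[0, 1]` with base `m` digits in `{0, m - 1}`. -/
def cantor (m : ℕ) : Set ℝ :=
  {x | x ∈ Set.Icc (0 : ℝ) 1 ∧ ∃ a : ℕ → ℝ, (∀ i, a i = 0 ∨ a i = (m : ℝ) - 1) ∧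
    HasSum (fun i => a i / (m : ℝ) ^ (i + 1)) x}

/-- The numbers in `[0, 1]` with a finite base `m` expansion with digits in `{0, m - 1}`. -/
def cantorB (m : ℕ) : Set ℝ :=
  {x | x ∈ Set.Icc (0 : ℝ) 1 ∧ ∃ (r : ℕ) (a : ℕ → ℝ), (∀ i, a i = 0 ∨ a i = (m : ℝ) - 1) ∧
    x = ∑ i ∈ Finset.range r, a i / (m : ℝ) ^ (i + 1)}

/-- Bi-Lipschitz equivalence of two sets of real numbers. -/
def BiLipschitzEquivalent (A B : Set ℝ) : Prop :=
  ∃ f : ℝ → ℝ, Set.BijOn f A B ∧ ∃ c C : ℝ, 0 < c ∧ 0 < C ∧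
    ∀ x ∈ A, ∀ y ∈ A, c * |x - y| ≤ |f x - f y| ∧ |f x - f y| ≤ C * |x - y|

/-- `H` is, on `I`, a (left-continuous, increasing) jump function with jump set `D`: a constant
plus the sum of summable positive jumps `h y` located at the points `y ∈ D`. -/
def IsJumpFunctionOn (H : ℝ → ℝ) (I D : Set ℝ) : Prop :=
  ∃ (c : ℝ) (h : ℝ → ℝ), (∀ y ∈ D, 0 < h y) ∧ Summable (fun y : D => h y) ∧
    ∀ x ∈ I, H x = c + ∑' y : {y : ℝ // y ∈ D ∧ y < x}, h y

end ZetaStarDeformation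

end

open ZetaStarDeformation

/-!
Expanding the product of geometric sums, `T n k r` becomes the sum of `∏ 1 / e_l` over the chains
`e_1 ≥ e_2 ≥ ⋯ ≥ 1` of integers that drop by at most `n`, and only after the positions of the
digits `1` in the binary expansion `τ k`. Grouping the chains by `m = e_1` turns `F n` into the
sum over `m` of a vector `limVec n x m`, on which the two inverse branches `x ↦ x / 2` and
`x ↦ (1 + x) / 2` of the doubling map act by the window sums
`(avg w v) m = (v m + v (m - 1) + ⋯ + v (m - w + 1)) / m` of widths `w = 1` and `w = n + 1`
(`limVec_half`, `limVec_half_add`). Passing from iterated integrals to window sums is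
`setIntegral_weight`. The eigensequences `eig n q` of the window sum of width `n + 1`, with
eigenvalue `1 / q`, are summable, and serve as majorants: `limVec n x ≤ eig n 1`.

At `1 / 2` the vector `limVec n` drops by `jumpVec n`, which vanishes below the index `n + 2` and
is at most `eig n (n + 2)`; at the dyadic point `0.u1` it drops by the image `wordVec n u` of
`jumpVec n` under the window sums of the letters of `u`. Its total mass `jump n u` therefore lies
between two constant multiples of `(n + 2)⁻¹ ^ |u|` (`le_jump`, `jump_le`). The function `H` is
the sum of these jumps over the dyadic points to the left of `x`. Replacing each jump by
`(n + 2)⁻¹ ^ |u|` gives, up to a factor, the map `cantorMap n` that rereads binary digits as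
digits `0`, `n + 1` in base `n + 2`; so the comparison of the jumps is the bi-Lipschitz
equivalence of `H ((0, 1])` with `C \ C^b`, the bijective image of `(0, 1]` under `cantorMap n`.

Adding the jumps to `limVec n` gives `contVec n`, which satisfies
`contVec n (x / 2) = avg 1 (contVec n x)` and
`contVec n ((1 + x) / 2) = avg (n + 1) (contVec n x) + avg 1 (contVec n 1)`. Its increments across
any dyadic interval are thus images of a nonnegative vector under positive operators, so that it
is monotone (`contVec_mono`), and since it is dominated by `eig n 2`, which belongs to the
eigenvalue `1 / 2`, they are at most of the order of its length (`contVec_sub_le_geometric`). The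
component of index `2` of `contVec n x` is `x` itself, which makes the sum `G` strictly
increasing.

The dimension of `C \ C^b` is computed from the cover by `2 ^ L` intervals of length
`(n + 2)⁻¹ ^ L` and from the Hölder continuity of the inverse of `cantorMap n`
(`cantorMap_sub_ge`).
-/

noncomputable section

namespace ZetaStarDeformation

/-! ### Window sums on sequences -/

/-- The operator `v ↦ (m⁻¹ (v m + v (m - 1) + ⋯ + v (m - w + 1)))_m` on real sequences. It is only
used on sequences with `v 0 = 0`, so that the truncated indices `m - j = 0` contribute nothing;
the value at `m = 0` is the junk value `0`. -/
def avg (w : ℕ) (v : ℕ → ℝ) (m : ℕ) : ℝ := (∑ j ∈ Finset.range w, v (m - j)) / m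

@[simp] lemma avg_zero_right (w : ℕ) (v : ℕ → ℝ) : avg w v 0 = 0 := by simp [avg]

lemma avg_one (v : ℕ → ℝ) (m : ℕ) : avg 1 v m = v m / m := by simp [avg]

lemma avg_succ (n : ℕ) (v : ℕ → ℝ) (m : ℕ) :
    avg (n + 1) v m = (v m + ∑ j ∈ Finset.range n, v (m - 1 - j)) / m := by
  rw [avg, Finset.sum_range_succ', add_comm]
  simp only [Nat.sub_zero]
  congr 3
  funext j
  rw [Nat.sub_sub, Nat.add_comm 1 j]

lemma avg_mono {w : ℕ} {u v : ℕ → ℝ} (h : ∀ m, u m ≤ v m) (m : ℕ) : avg w u m ≤ avg w v m := by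
  unfold avg
  gcongr
  exact h _

lemma avg_nonneg {w : ℕ} {v : ℕ → ℝ} (h : ∀ m, 0 ≤ v m) (m : ℕ) : 0 ≤ avg w v m :=
  div_nonneg (Finset.sum_nonneg fun _ _ => h _) m.cast_nonneg

lemma avg_mono_width {w w' : ℕ} (hw : w ≤ w') {v : ℕ → ℝ} (h : ∀ m, 0 ≤ v m) (m : ℕ) :
    avg w v m ≤ avg w' v m := by
  unfold avg
  gcongr
  · exact fun _ _ _ => h _

lemma avg_add (w : ℕ) (u v : ℕ → ℝ) (m : ℕ) :
    avg w (fun i => u i + v i) m = avg w u m + avg w v m := by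
  simp only [avg, Finset.sum_add_distrib, add_div]

lemma avg_sub (w : ℕ) (u v : ℕ → ℝ) (m : ℕ) :
    avg w (fun i => u i - v i) m = avg w u m - avg w v m := by
  simp only [avg, Finset.sum_sub_distrib, sub_div]

lemma avg_const_mul (w : ℕ) (c : ℝ) (v : ℕ → ℝ) (m : ℕ) :
    avg w (fun i => c * v i) m = c * avg w v m := by
  simp only [avg, ← Finset.mul_sum, mul_div_assoc]

lemma avg_of_lt {w q : ℕ} {v : ℕ → ℝ} (h : ∀ m < q, v m = 0) {m : ℕ} (hm : m < q) :
    avg w v m = 0 := by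
  rw [avg, Finset.sum_eq_zero fun j _ => h _ (by omega), zero_div]

lemma avg_eq_of_first {w q : ℕ} (hw : 1 ≤ w) {v : ℕ → ℝ} (h : ∀ m < q, v m = 0) (hq : 1 ≤ q) :
    avg w v q = v q / q := by
  obtain ⟨w, rfl⟩ := Nat.exists_eq_add_of_le' hw
  rw [avg_succ, Finset.sum_eq_zero fun j _ => h _ (by omega), add_zero]

lemma tendsto_avg {ι : Type*} {l : Filter ι} (w : ℕ) {u : ι → ℕ → ℝ} {v : ℕ → ℝ}
    (h : ∀ m, Tendsto (fun i => u i m) l (𝓝 (v m))) (m : ℕ) :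
    Tendsto (fun i => avg w (u i) m) l (𝓝 (avg w v m)) :=
  (tendsto_finsetSum _ fun _ _ => h _).div_const _

lemma avg_tsum {ι : Type*} (w : ℕ) {u : ι → ℕ → ℝ} (h : ∀ m, Summable fun i => u i m) (m : ℕ) :
    avg w (fun m => ∑' i, u i m) m = ∑' i, avg w (u i) m := by
  simp only [avg]
  rw [tsum_div_const, Summable.tsum_finsetSum fun _ _ => h _]

/-! ### Eigensequences of the full window sum -/

/-- A nonnegative sequence each of whose terms is eventually at most `K / p` times the sum of
its `n` predecessors decays geometrically. -/
lemma summable_of_window_bound {n p₀ : ℕ} {K : ℝ} {f : ℕ → ℝ} (hf : ∀ p, 0 ≤ f p) (hK : 0 ≤ K)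
    (h : ∀ p, p₀ < p → (p : ℝ) * f p ≤ K * ∑ j ∈ Finset.range n, f (p - 1 - j)) :
    Summable f := by
  -- Beyond `p₁` the recursion preserves a bound of the form `f p ≤ C * 2⁻¹ ^ p`.
  obtain ⟨p₁, hp₁⟩ := exists_nat_ge (K * n * 2 ^ n)
  set q := p₀ + p₁ + n with hq
  set C := ∑ i ∈ Finset.range (q + 1), f i * 2 ^ i with hC
  have hC0 : 0 ≤ C := Finset.sum_nonneg fun i _ => mul_nonneg (hf i) (by positivity)
  have key : ∀ p, f p * 2 ^ p ≤ C := by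
    intro p
    induction p using Nat.strong_induction_on with
    | _ p ih =>
    rcases le_or_gt p q with hp | hp
    · exact Finset.single_le_sum (f := fun i => f i * 2 ^ i)
        (fun i _ => mul_nonneg (hf i) (by positivity)) (by simp; omega)
    · have hp0 : (0 : ℝ) < p := by exact_mod_cast (by omega : 0 < p)
      have h1 : ∀ j ∈ Finset.range n, f (p - 1 - j) * 2 ^ p ≤ C * 2 ^ n := by
        intro j hj
        have hj := Finset.mem_range.1 hj
        have e : (2 : ℝ) ^ p = 2 ^ (p - 1 - j) * 2 ^ (j + 1) := by
          rw [← pow_add]; congr 1; omega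
        rw [e, ← mul_assoc]
        exact mul_le_mul (ih _ (by omega)) (pow_le_pow_right₀ (by norm_num) (by omega))
          (by positivity) hC0
      have h2 : (p : ℝ) * (f p * 2 ^ p) ≤ p * C := by
        calc (p : ℝ) * (f p * 2 ^ p) = (p * f p) * 2 ^ p := by ring
          _ ≤ (K * ∑ j ∈ Finset.range n, f (p - 1 - j)) * 2 ^ p := by
              exact mul_le_mul_of_nonneg_right (h p (by omega)) (by positivity)
          _ = K * ∑ j ∈ Finset.range n, f (p - 1 - j) * 2 ^ p := by rw [mul_assoc, Finset.sum_mul]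
          _ ≤ K * ∑ j ∈ Finset.range n, C * 2 ^ n := 
              mul_le_mul_of_nonneg_left (Finset.sum_le_sum h1) hK
          _ = (K * n * 2 ^ n) * C := by simp; ring
          _ ≤ p * C := by
              gcongr
              exact hp₁.trans (by exact_mod_cast (by omega : p₁ ≤ p))
      exact le_of_mul_le_mul_left h2 hp0
  refine Summable.of_nonneg_of_le hf (fun p => ?_)
    ((summable_geometric_of_lt_one (by norm_num) (by norm_num : (1 / 2 : ℝ) < 1)).mul_left C)
  have := key p
  rw [one_div, inv_pow, ← div_eq_mul_inv, le_div_iff₀ (by positivity)]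
  exact this

/-- The sequence that vanishes below `q`, takes the value `1` at `q` and is an eigenvector of
`avg (n + 1)` for the eigenvalue `1 / q`; its generating function is
`x ^ q * exp (q * (x + x ^ 2 / 2 + ⋯ + x ^ n / n))`. -/
def eig (n q : ℕ) (m : ℕ) : ℝ :=
  if _h : m ≤ q then (if m = q then 1 else 0)
  else (q : ℝ) / ((m : ℝ) - q) * ∑ j ∈ Finset.range n, eig n q (m - 1 - j)
termination_by m
decreasing_by omega

lemma eig_of_lt {n q m : ℕ} (h : m < q) : eig n q m = 0 := by
  rw [eig, dif_pos h.le, if_neg h.ne]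

@[simp] lemma eig_self (n q : ℕ) : eig n q q = 1 := by
  rw [eig, dif_pos le_rfl, if_pos rfl]

lemma eig_rec {n q m : ℕ} (h : q ≤ m) :
    ((m : ℝ) - q) * eig n q m = q * ∑ j ∈ Finset.range n, eig n q (m - 1 - j) := by
  rcases h.eq_or_lt with rfl | h
  · rcases Nat.eq_zero_or_pos q with rfl | hq
    · simp
    · rw [Finset.sum_eq_zero fun j _ => eig_of_lt (by omega)]; simp
  · have : (0 : ℝ) < (m : ℝ) - q := sub_pos.2 (by exact_mod_cast h)
    rw [eig, dif_neg (by omega)]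
    field_simp

lemma eig_nonneg (n q m : ℕ) : 0 ≤ eig n q m := by
  induction m using Nat.strong_induction_on with
  | _ m ih =>
  rw [eig]
  split_ifs with h h'
  · exact zero_le_one
  · exact le_rfl
  · have : (0 : ℝ) < (m : ℝ) - q := sub_pos.2 (by exact_mod_cast (by omega : q < m))
    exact mul_nonneg (by positivity) (Finset.sum_nonneg fun j _ => ih _ (by omega))

lemma avg_eig {n q : ℕ} (hq : 1 ≤ q) (m : ℕ) : avg (n + 1) (eig n q) m = eig n q m / q := by
  rcases lt_or_ge m q with h | h
  · rw [avg_of_lt (fun _ => eig_of_lt) h, eig_of_lt h, zero_div]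
  · have hm : (0 : ℝ) < m := by exact_mod_cast (by omega : 0 < m)
    have hq' : (0 : ℝ) < q := by exact_mod_cast hq
    rw [avg_succ, div_eq_div_iff hm.ne' hq'.ne']
    linarith [eig_rec (n := n) h]

lemma summable_eig (n : ℕ) (q : ℕ) : Summable (eig n q) := by
  refine summable_of_window_bound (n := n) (p₀ := 2 * q) (K := 2 * q) (eig_nonneg n q)
    (by positivity) fun p hp => ?_
  have h1 := eig_rec (n := n) (q := q) (m := p) (by omega)
  have h2 : (p : ℝ) ≤ 2 * (p - q) := by
    have : ((2 * q : ℕ) : ℝ) < p := by exact_mod_cast hp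
    push_cast at this
    linarith
  calc (p : ℝ) * eig n q p ≤ 2 * (p - q) * eig n q p :=
        mul_le_mul_of_nonneg_right h2 (eig_nonneg _ _ _)
    _ = _ := by rw [mul_assoc, h1, mul_assoc]

/-- A fixed point of `avg (n + 1)` is determined by its values at `0` and `1`. -/
lemma eq_eig_one {n : ℕ} {v : ℕ → ℝ} (h0 : v 0 = 0) (h1 : v 1 = 1)
    (h : ∀ m, v m = avg (n + 1) v m) (m : ℕ) : v m = eig n 1 m := by
  induction m using Nat.strong_induction_on with
  | _ m ih =>
  rcases Nat.lt_or_ge m 2 with hm | hm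
  · interval_cases m
    · rw [h0, eig_of_lt one_pos]
    · rw [h1, eig_self]
  · have hm' : (2 : ℝ) ≤ m := by exact_mod_cast hm
    have e1 := h m
    rw [avg_succ, eq_div_iff (by positivity),
      Finset.sum_congr rfl fun j _ => ih (m - 1 - j) (by omega)] at e1
    have e2 := eig_rec (n := n) (q := 1) (m := m) (by omega)
    have e3 : ((m : ℝ) - 1) * v m = (m - 1) * eig n 1 m := by push_cast at e2; linarith
    exact mul_left_cancel₀ (by linarith) e3

lemma eig_one_eq_one {n m : ℕ} (h1 : 1 ≤ m) (hm : m ≤ n + 1) : eig n 1 m = 1 := by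
  induction m using Nat.strong_induction_on with
  | _ m ih =>
  rcases h1.eq_or_lt with rfl | h
  · exact eig_self n 1
  · have e := eig_rec (n := n) (q := 1) (m := m) (by omega)
    have hsum : ∑ j ∈ Finset.range n, eig n 1 (m - 1 - j) = (m : ℝ) - 1 := by
      obtain ⟨i, rfl⟩ : ∃ i, n = (m - 1) + i := ⟨n - (m - 1), by omega⟩
      rw [Finset.sum_range_add, Finset.sum_eq_zero (s := Finset.range i)
        fun j _ => eig_of_lt (by omega), add_zero,
        Finset.sum_congr rfl fun j hj => ih (m - 1 - j) (by omega)
          (by have := Finset.mem_range.1 hj; omega) (by omega)]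
      simp [Nat.cast_sub h1]
    rw [hsum] at e
    have : (2 : ℝ) ≤ m := by exact_mod_cast h
    push_cast at e
    exact mul_left_cancel₀ (b := eig n 1 m) (by linarith : (m : ℝ) - 1 ≠ 0) (by linarith)

lemma eig_one_le_one (n m : ℕ) : eig n 1 m ≤ 1 := by
  induction m using Nat.strong_induction_on with
  | _ m ih =>
  rcases Nat.lt_or_ge (n + 1) m with h | h
  · have e := eig_rec (n := n) (q := 1) (m := m) (by omega)
    have h2 : ∑ j ∈ Finset.range n, eig n 1 (m - 1 - j) ≤ n := by
      simpa using Finset.sum_le_card_nsmul (Finset.range n) (fun j => eig n 1 (m - 1 - j)) 1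
        fun j _ => ih _ (by omega)
    have h3 : (n : ℝ) + 1 < m := by exact_mod_cast h
    have h4 : (0 : ℝ) ≤ n := n.cast_nonneg
    push_cast at e
    refine le_of_mul_le_mul_left (a := (m : ℝ) - 1) ?_ (by linarith)
    linarith
  · rcases Nat.eq_zero_or_pos m with rfl | h0
    · rw [eig_of_lt one_pos]; exact zero_le_one
    · exact (eig_one_eq_one h0 h).le

/-- On `[q, 2 * q]` the recursion of `eig n q` has a factor `q / (m - q) ≥ 1`, so that no term is
smaller than its predecessor. -/
lemma one_le_eig {n q m : ℕ} (hn : 1 ≤ n) (h1 : q ≤ m) (h2 : m ≤ 2 * q) : 1 ≤ eig n q m := by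
  induction m, h1 using Nat.le_induction with
  | base => simp
  | succ m hm ih =>
    have e := eig_rec (n := n) (q := q) (m := m + 1) (by omega)
    have h3 : eig n q m ≤ ∑ j ∈ Finset.range n, eig n q (m + 1 - 1 - j) :=
      Finset.single_le_sum (f := fun j => eig n q (m + 1 - 1 - j))
        (fun j _ => eig_nonneg _ _ _) (Finset.mem_range.2 hn)
    have h4 : (0 : ℝ) < ((m + 1 : ℕ) : ℝ) - q := sub_pos.2 (by exact_mod_cast (by omega))
    have h5 : ((m + 1 : ℕ) : ℝ) - q ≤ q := by
      have : ((m + 1 : ℕ) : ℝ) ≤ (2 * q : ℕ) := by exact_mod_cast h2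
      push_cast at this ⊢
      linarith
    refine le_of_mul_le_mul_left (a := ((m + 1 : ℕ) : ℝ) - q) ?_ h4
    rw [e, mul_one]
    have := ih (by omega)
    nlinarith

/-- From the index `n + 2` on, `eig n (n + 2)` dominates: it is at least `1 ≥ eig n 1` on a whole
window, and its recursion has the larger factor afterwards. -/
lemma eig_one_le_eig {n m : ℕ} (hn : 1 ≤ n) (h : n + 2 ≤ m) : eig n 1 m ≤ eig n (n + 2) m := by
  induction m using Nat.strong_induction_on with
  | _ m ih =>
  rcases le_or_gt m (2 * (n + 2)) with hm | hm
  · exact (eig_one_le_one n m).trans (one_le_eig hn h hm)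
  · have e1 := eig_rec (n := n) (q := 1) (m := m) (by omega)
    have e2 := eig_rec (n := n) (q := n + 2) (m := m) (by omega)
    have h1 : ∑ j ∈ Finset.range n, eig n 1 (m - 1 - j) ≤
        ∑ j ∈ Finset.range n, eig n (n + 2) (m - 1 - j) :=
      Finset.sum_le_sum fun j hj => by
        have := Finset.mem_range.1 hj
        exact ih _ (by omega) (by omega)
    have h2 : ((2 * (n + 2) : ℕ) : ℝ) < m := by exact_mod_cast hm
    have h3 : (0 : ℝ) ≤ n := n.cast_nonneg
    have h4 := eig_nonneg n (n + 2) m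
    have h5 : 0 ≤ ∑ j ∈ Finset.range n, eig n (n + 2) (m - 1 - j) :=
      Finset.sum_nonneg fun j _ => eig_nonneg _ _ _
    push_cast at e1 e2 h2
    refine le_of_mul_le_mul_left (a := (m : ℝ) - 1) ?_ (by linarith)
    nlinarith [mul_nonneg h3 h4, mul_nonneg h3 h5]

/-! ### The doubling map on the half-open unit interval -/

/-- The doubling map of `(0, 1]`, i.e. the shift of binary expansions with infinitely many digits
`1`; the point `1 / 2 = 0.0111…` belongs to the left branch. -/
def dbl (x : ℝ) : ℝ := if x ≤ 1 / 2 then 2 * x else 2 * x - 1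

lemma dbl_mem {x : ℝ} (hx : x ∈ Ioc (0 : ℝ) 1) : dbl x ∈ Ioc (0 : ℝ) 1 := by
  obtain ⟨h0, h1⟩ := hx
  unfold dbl
  split_ifs with h
  · constructor <;> linarith
  · constructor <;> linarith

lemma half_mem {x : ℝ} (hx : x ∈ Ioc (0 : ℝ) 1) : x / 2 ∈ Ioc (0 : ℝ) 1 :=
  ⟨by linarith [hx.1], by linarith [hx.2]⟩

lemma one_mem_Ioc : (1 : ℝ) ∈ Ioc (0 : ℝ) 1 := ⟨one_pos, le_rfl⟩

lemma half_le {x : ℝ} (hx : x ∈ Ioc (0 : ℝ) 1) : x / 2 ≤ 1 / 2 := by linarith [hx.2]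

lemma not_half_add_le {x : ℝ} (hx : x ∈ Ioc (0 : ℝ) 1) : ¬ (1 + x) / 2 ≤ 1 / 2 := by
  linarith [hx.1]

lemma dbl_half {x : ℝ} (hx : x ∈ Ioc (0 : ℝ) 1) : dbl (x / 2) = x := by
  rw [dbl, if_pos (half_le hx)]; ring

lemma dbl_half_add {x : ℝ} (hx : x ∈ Ioc (0 : ℝ) 1) : dbl ((1 + x) / 2) = x := by
  rw [dbl, if_neg (not_half_add_le hx)]; ring

lemma exists_eq_half {x : ℝ} (hx : x ∈ Ioc (0 : ℝ) 1) :
    ∃ y ∈ Ioc (0 : ℝ) 1, x = y / 2 ∨ x = (1 + y) / 2 := by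
  refine ⟨dbl x, dbl_mem hx, ?_⟩
  unfold dbl
  split_ifs
  · left; ring
  · right; ring

/-- Induction on the position of the first differing binary digit of two points of `(0, 1]`. -/
lemma digit_induction {p : ℝ → ℝ → Prop}
    (h0 : ∀ x ∈ Ioc (0 : ℝ) 1, ∀ y ∈ Ioc (0 : ℝ) 1, x < y → p x y → p (x / 2) (y / 2))
    (h1 : ∀ x ∈ Ioc (0 : ℝ) 1, ∀ y ∈ Ioc (0 : ℝ) 1, x < y → p x y →
      p ((1 + x) / 2) ((1 + y) / 2))
    (h01 : ∀ x ∈ Ioc (0 : ℝ) 1, ∀ y ∈ Ioc (0 : ℝ) 1, p (x / 2) ((1 + y) / 2))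
    {x y : ℝ} (hx : x ∈ Ioc (0 : ℝ) 1) (hy : y ∈ Ioc (0 : ℝ) 1) (hxy : x < y) : p x y := by
  obtain ⟨L, hL⟩ := exists_pow_lt_of_lt_one (sub_pos.2 hxy) (by norm_num : (1 / 2 : ℝ) < 1)
  induction L generalizing x y with
  | zero => simp at hL; linarith [hx.1, hy.2]
  | succ L ih =>
    rw [pow_succ] at hL
    obtain ⟨a, ha, rfl | rfl⟩ := exists_eq_half hx <;>
      obtain ⟨b, hb, rfl | rfl⟩ := exists_eq_half hy
    · exact h0 a ha b hb (by linarith) (ih ha hb (by linarith) (by linarith))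
    · exact h01 a ha b hb
    · linarith [ha.1, hb.2]
    · exact h1 a ha b hb (by linarith) (ih ha hb (by linarith) (by linarith))

/-! ### The weights of the chains with a given exponent at the first coordinate -/

/-- The number of summands of the window sum attached to the first binary digit of `x`. -/
def width (n : ℕ) (x : ℝ) : ℕ := if x ≤ 1 / 2 then 1 else n + 1

lemma width_half (n : ℕ) {x : ℝ} (hx : x ∈ Ioc (0 : ℝ) 1) : width n (x / 2) = 1 :=
  if_pos (half_le hx)

lemma width_half_add (n : ℕ) {x : ℝ} (hx : x ∈ Ioc (0 : ℝ) 1) :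
    width n ((1 + x) / 2) = n + 1 :=
  if_neg (not_half_add_le hx)

lemma one_le_width (n : ℕ) (x : ℝ) : 1 ≤ width n x := by unfold width; split_ifs <;> omega

lemma width_le (n : ℕ) (x : ℝ) : width n x ≤ n + 1 := by unfold width; split_ifs <;> omega

/-- `partialVec n N x m` is the sum of `∏ 1 / e_l` over the sequences
`m = e_1 ≥ e_2 ≥ ⋯ ≥ e_N ≥ e_{N+1} = 1` of integers which drop by at most `n` after the
positions of the binary digits `1` of `x`, and do not drop elsewhere. -/
def partialVec (n : ℕ) : ℕ → ℝ → ℕ → ℝ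
  | 0, _ => Pi.single 1 1
  | N + 1, x => avg (width n x) (partialVec n N (dbl x))

lemma partialVec_zero_right (n N : ℕ) (x : ℝ) : partialVec n N x 0 = 0 := by
  cases N <;> simp [partialVec]

lemma partialVec_nonneg (n N : ℕ) (x : ℝ) (m : ℕ) : 0 ≤ partialVec n N x m := by
  induction N generalizing x m with
  | zero =>
    by_cases h : m = 1
    · simp [partialVec, h]
    · simp [partialVec, h]
  | succ N ih => exact avg_nonneg (ih _) m

lemma partialVec_one_right (n N : ℕ) (x : ℝ) : partialVec n N x 1 = 1 := by
  induction N generalizing x with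
  | zero => simp [partialVec]
  | succ N ih =>
    rw [partialVec, avg_eq_of_first (one_le_width n x) (fun m hm => ?_) le_rfl, ih]
    · simp
    · rw [Nat.lt_one_iff.1 hm, partialVec_zero_right]

lemma single_le_of {v : ℕ → ℝ} (hv : ∀ m, 0 ≤ v m) (h1 : v 1 = 1) (m : ℕ) :
    (Pi.single 1 1 : ℕ → ℝ) m ≤ v m := by
  by_cases h : m = 1
  · simp [h, h1]
  · simp [h, hv m]

lemma partialVec_le_succ (n N : ℕ) (x : ℝ) (m : ℕ) :
    partialVec n N x m ≤ partialVec n (N + 1) x m := by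
  induction N generalizing x m with
  | zero => exact single_le_of (partialVec_nonneg n 1 x) (partialVec_one_right n 1 x) m
  | succ N ih => exact avg_mono (ih _) m

lemma partialVec_le_eig (n N : ℕ) (x : ℝ) (m : ℕ) : partialVec n N x m ≤ eig n 1 m := by
  induction N generalizing x m with
  | zero => exact single_le_of (eig_nonneg n 1) (eig_self n 1) m
  | succ N ih =>
    calc partialVec n (N + 1) x m ≤ avg (width n x) (eig n 1) m := avg_mono (ih _) m
      _ ≤ avg (n + 1) (eig n 1) m := avg_mono_width (width_le n x) (eig_nonneg n 1) m
      _ = eig n 1 m := by rw [avg_eig le_rfl]; simp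

lemma partialVec_eq_zero (n : ℕ) {N m : ℕ} (x : ℝ) (h : n * N + 1 < m) :
    partialVec n N x m = 0 := by
  induction N generalizing x m with
  | zero => exact Pi.single_eq_of_ne (by omega) _
  | succ N ih =>
    rw [partialVec, avg, Finset.sum_eq_zero, zero_div]
    intro j hj
    have := Finset.mem_range.1 hj
    have := width_le n x
    exact ih _ (by rw [Nat.mul_succ] at h; omega)

/-- The limit of `partialVec n N x` as `N → ∞`. -/
def limVec (n : ℕ) (x : ℝ) (m : ℕ) : ℝ := ⨆ N, partialVec n N x m

lemma tendsto_partialVec (n : ℕ) (x : ℝ) (m : ℕ) :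
    Tendsto (fun N => partialVec n N x m) atTop (𝓝 (limVec n x m)) :=
  tendsto_atTop_ciSup (monotone_nat_of_le_succ fun N => partialVec_le_succ n N x m)
    ⟨eig n 1 m, by rintro _ ⟨N, rfl⟩; exact partialVec_le_eig n N x m⟩

lemma limVec_eq_avg (n : ℕ) (x : ℝ) (m : ℕ) :
    limVec n x m = avg (width n x) (limVec n (dbl x)) m :=
  tendsto_nhds_unique ((tendsto_add_atTop_iff_nat 1).2 (tendsto_partialVec n x m))
    (tendsto_avg (width n x) (tendsto_partialVec n (dbl x)) m)

lemma limVec_half (n : ℕ) {x : ℝ} (hx : x ∈ Ioc (0 : ℝ) 1) (m : ℕ) :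
    limVec n (x / 2) m = avg 1 (limVec n x) m := by
  rw [limVec_eq_avg, width_half n hx, dbl_half hx]

lemma limVec_half_add (n : ℕ) {x : ℝ} (hx : x ∈ Ioc (0 : ℝ) 1) (m : ℕ) :
    limVec n ((1 + x) / 2) m = avg (n + 1) (limVec n x) m := by
  rw [limVec_eq_avg, width_half_add n hx, dbl_half_add hx]

lemma limVec_le_eig (n : ℕ) (x : ℝ) (m : ℕ) : limVec n x m ≤ eig n 1 m :=
  ciSup_le fun N => partialVec_le_eig n N x m

lemma limVec_zero_right (n : ℕ) (x : ℝ) : limVec n x 0 = 0 := by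
  simp [limVec, partialVec_zero_right]

lemma limVec_one_right (n : ℕ) (x : ℝ) : limVec n x 1 = 1 := by
  simp [limVec, partialVec_one_right]

lemma limVec_nonneg (n : ℕ) (x : ℝ) (m : ℕ) : 0 ≤ limVec n x m :=
  Real.iSup_nonneg fun N => partialVec_nonneg n N x m

lemma limVec_one (n m : ℕ) : limVec n 1 m = eig n 1 m := by
  refine eq_eig_one (limVec_zero_right n 1) (limVec_one_right n 1) (fun m => ?_) m
  have := limVec_half_add n one_mem_Ioc m
  norm_num at this
  exact this

lemma abs_partialVec_two_sub_le {n : ℕ} (hn : 1 ≤ n) (N : ℕ) {x : ℝ} (hx : x ∈ Ioc (0 : ℝ) 1) :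
    |partialVec n N x 2 - x| ≤ (1 / 2) ^ N := by
  induction N generalizing x with
  | zero => simp [partialVec, abs_le]; constructor <;> linarith [hx.1, hx.2]
  | succ N ih =>
    obtain ⟨y, hy, rfl | rfl⟩ := exists_eq_half hx
    · rw [partialVec, width_half n hy, dbl_half hy, avg_one, Nat.cast_ofNat, ← sub_div, abs_div,
        abs_of_pos (two_pos : (0 : ℝ) < 2), pow_succ]
      linarith [ih hy]
    · obtain ⟨n, rfl⟩ := Nat.exists_eq_add_of_le' hn
      have e : ∑ j ∈ Finset.range (n + 1), partialVec (n + 1) N y (2 - 1 - j) = 1 := by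
        rw [Finset.sum_range_succ', Finset.sum_eq_zero fun j _ => ?_]
        · simp [partialVec_one_right]
        · rw [show 2 - 1 - (j + 1) = 0 by omega, partialVec_zero_right]
      rw [partialVec, width_half_add _ hy, dbl_half_add hy, avg_succ, e, Nat.cast_ofNat,
        ← sub_div, abs_div, abs_of_pos (two_pos : (0 : ℝ) < 2), pow_succ, add_comm,
        add_sub_add_left_eq_sub]
      linarith [ih hy]

/-- The component of index `2` of `limVec n x` recovers `x`. -/
lemma limVec_two {n : ℕ} (hn : 1 ≤ n) {x : ℝ} (hx : x ∈ Ioc (0 : ℝ) 1) : limVec n x 2 = x := by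
  have h := (tendsto_partialVec n x 2).sub_const x |>.abs
  have h0 : Tendsto (fun N : ℕ => (1 / 2 : ℝ) ^ N) atTop (𝓝 0) :=
    tendsto_pow_atTop_nhds_zero_of_lt_one (by norm_num) (by norm_num)
  have := le_of_tendsto_of_tendsto' h h0 fun N => abs_partialVec_two_sub_le hn N hx
  exact sub_eq_zero.1 (abs_nonpos_iff.1 this)

lemma summable_limVec (n : ℕ) (x : ℝ) : Summable (limVec n x) :=
  (summable_eig n 1).of_nonneg_of_le (limVec_nonneg n x) (limVec_le_eig n x)

lemma tendsto_tsum_partialVec (n : ℕ) (x : ℝ) :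
    Tendsto (fun N => ∑' m, partialVec n N x m) atTop (𝓝 (∑' m, limVec n x m)) := by
  refine tendsto_tsum_of_dominated_convergence (summable_eig n 1)
    (fun m => tendsto_partialVec n x m) (Eventually.of_forall fun N m => ?_)
  rw [Real.norm_of_nonneg (partialVec_nonneg n N x m)]
  exact partialVec_le_eig n N x m

lemma one_lt_tsum_limVec {n : ℕ} (hn : 1 ≤ n) {x : ℝ} (hx : x ∈ Ioc (0 : ℝ) 1) :
    1 < ∑' m, limVec n x m := by
  have h := (summable_limVec n x).sum_le_tsum {1, 2} fun m _ => limVec_nonneg n x m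
  rw [Finset.sum_pair (by norm_num), limVec_one_right, limVec_two hn hx] at h
  linarith [hx.1]

/-! ### Dyadic points as finite words -/

/-- The dyadic number in `(0, 1)` with the finite binary expansion `0.u1`. -/
def dyad : List Bool → ℝ
  | [] => 1 / 2
  | false :: u => dyad u / 2
  | true :: u => (1 + dyad u) / 2

lemma dyad_mem (u : List Bool) : dyad u ∈ Ioo (0 : ℝ) 1 := by
  induction u with
  | nil => norm_num [dyad]
  | cons b u ih =>
    cases b <;> simp only [dyad, mem_Ioo] at ih ⊢ <;> constructor <;> linarith [ih.1, ih.2]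

lemma dyad_injective : Function.Injective dyad := by
  intro u
  induction u with
  | nil =>
    intro v h
    rcases v with _ | ⟨b, v⟩
    · rfl
    · have := dyad_mem v
      cases b <;> simp only [dyad, mem_Ioo] at h this <;> linarith [this.1, this.2]
  | cons b u ih =>
    intro v h
    have hu := dyad_mem u
    rcases v with _ | ⟨c, v⟩
    · cases b <;> simp only [dyad, mem_Ioo] at h hu <;> linarith [hu.1, hu.2]
    · have hv := dyad_mem v
      cases b <;> cases c <;> simp only [dyad, mem_Ioo] at h hu hv
      · rw [ih (by linarith : dyad u = dyad v)]
      · linarith [hu.1, hu.2, hv.1, hv.2]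
      · linarith [hu.1, hu.2, hv.1, hv.2]
      · rw [ih (by linarith : dyad u = dyad v)]

lemma range_dyad :
    range dyad = {x : ℝ | x ∈ Ioo (0 : ℝ) 1 ∧ ∃ l m : ℕ, (2 : ℝ) ^ l * x = m} := by
  ext x
  constructor
  · rintro ⟨u, rfl⟩
    refine ⟨dyad_mem u, ?_⟩
    induction u with
    | nil => exact ⟨1, 1, by norm_num [dyad]⟩
    | cons b u ih =>
      obtain ⟨l, m, h⟩ := ih
      cases b
      · exact ⟨l + 1, m, by simp only [dyad]; rw [pow_succ, ← h]; ring⟩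
      · exact ⟨l + 1, m + 2 ^ l, by simp only [dyad]; push_cast; rw [pow_succ, ← h]; ring⟩
  · rintro ⟨hx, l, m, h⟩
    induction l generalizing x m with
    | zero =>
      have h1 : (0 : ℝ) < m := by rw [← h]; simpa using hx.1
      have h2 : (m : ℝ) < 1 := by rw [← h]; simpa using hx.2
      have h1 : 0 < m := by exact_mod_cast h1
      have h2 : m < 1 := by exact_mod_cast h2
      omega
    | succ l ih =>
      rcases lt_trichotomy x (1 / 2) with hlt | rfl | hlt
      · obtain ⟨u, hu⟩ := ih (x := 2 * x) ⟨by linarith [hx.1], by linarith⟩ m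
          (by rw [← h, pow_succ]; ring)
        exact ⟨false :: u, by simp only [dyad, hu]; ring⟩
      · exact ⟨[], rfl⟩
      · have hm : 2 ^ l ≤ m := by
          have : (2 : ℝ) ^ l ≤ m := by
            rw [← h, pow_succ]
            have : (0 : ℝ) < 2 ^ l := by positivity
            nlinarith
          exact_mod_cast this
        obtain ⟨u, hu⟩ := ih (x := 2 * x - 1) ⟨by linarith, by linarith [hx.2]⟩ (m - 2 ^ l)
          (by rw [Nat.cast_sub hm, ← h, pow_succ]; push_cast; ring)
        exact ⟨true :: u, by simp only [dyad, hu]; ring⟩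

lemma exists_dyad_mem {x y : ℝ} (hx : x ∈ Ioc (0 : ℝ) 1) (hy : y ∈ Ioc (0 : ℝ) 1) (hxy : x < y) :
    ∃ u, x ≤ dyad u ∧ dyad u < y := by
  refine digit_induction (p := fun x y => ∃ u, x ≤ dyad u ∧ dyad u < y) ?_ ?_ ?_ hx hy hxy
  · rintro x - y - - ⟨u, h1, h2⟩
    exact ⟨false :: u, by simp only [dyad]; linarith, by simp only [dyad]; linarith⟩
  · rintro x - y - - ⟨u, h1, h2⟩
    exact ⟨true :: u, by simp only [dyad]; linarith, by simp only [dyad]; linarith⟩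
  · rintro x hx y hy
    exact ⟨[], by simp only [dyad]; linarith [hx.2], by simp only [dyad]; linarith [hy.1]⟩

/-! ### Sums over finite words -/

/-- A nonempty word is a letter followed by a word. -/
def wordEquiv : Unit ⊕ (List Bool ⊕ List Bool) ≃ List Bool where
  toFun := Sum.elim (fun _ => []) (Sum.elim (List.cons false) (List.cons true))
  invFun
    | [] => Sum.inl ()
    | false :: u => Sum.inr (Sum.inl u)
    | true :: u => Sum.inr (Sum.inr u)
  left_inv := by rintro (_ | _ | _) <;> rfl
  right_inv := by rintro (_ | ⟨_ | _, _⟩) <;> rfl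

lemma tsum_word {f : List Bool → ℝ} (hf : Summable f) :
    ∑' u, f u = f [] + (∑' u, f (false :: u) + ∑' u, f (true :: u)) := by
  have h0 : Summable fun u => f (false :: u) := hf.comp_injective List.cons_injective
  have h1 : Summable fun u => f (true :: u) := hf.comp_injective List.cons_injective
  have := (hasSum_unique fun u : Unit => f []).sum (f := f ∘ wordEquiv)
    (HasSum.sum (f := (f ∘ wordEquiv) ∘ Sum.inr) h0.hasSum h1.hasSum)
  exact ((wordEquiv.hasSum_iff).1 this).tsum_eq

lemma summable_pow_length {r : ℝ} (h0 : 0 ≤ r) (h1 : 2 * r < 1) :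
    Summable fun u : List Bool => r ^ u.length := by
  rw [← (Equiv.sigmaFiberEquiv (List.length : List Bool → ℕ)).summable_iff]
  have hfib : ∀ L : ℕ, Finite {u : List Bool // u.length = L} := fun L =>
    inferInstanceAs (Finite (List.Vector Bool L))
  refine (summable_sigma_of_nonneg fun p => pow_nonneg h0 _).2 ⟨fun L => Summable.of_finite, ?_⟩
  refine (summable_geometric_of_lt_one (by linarith) h1).congr fun L => ?_
  have : ∀ u : {u : List Bool // u.length = L},
      r ^ (Equiv.sigmaFiberEquiv (List.length : List Bool → ℕ) ⟨L, u⟩).length = r ^ L := by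
    rintro ⟨u, rfl⟩; rfl
  rw [tsum_congr this, tsum_const, nsmul_eq_mul, mul_pow,
    show Nat.card {u : List Bool // u.length = L} = 2 ^ L by
      change Nat.card (List.Vector Bool L) = _
      rw [Nat.card_eq_fintype_card, card_vector, Fintype.card_bool]]
  push_cast
  rfl

/-! ### The jump vectors -/

/-- The difference of the one-sided limits of `limVec n` at `1 / 2`. -/
def jumpVec (n m : ℕ) : ℝ := if m < n + 2 then 0 else eig n 1 m / m

lemma jumpVec_nonneg (n m : ℕ) : 0 ≤ jumpVec n m := by
  unfold jumpVec
  split_ifs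
  · exact le_rfl
  · exact div_nonneg (eig_nonneg _ _ _) m.cast_nonneg

lemma jumpVec_le {n : ℕ} (hn : 1 ≤ n) (m : ℕ) : jumpVec n m ≤ eig n (n + 2) m := by
  unfold jumpVec
  split_ifs with h
  · exact eig_nonneg _ _ _
  · exact (div_le_self (eig_nonneg _ _ _) (by exact_mod_cast (by omega : 1 ≤ m))).trans
      (eig_one_le_eig hn (by omega))

lemma jumpVec_first_pos {n : ℕ} (hn : 1 ≤ n) : 0 < jumpVec n (n + 2) := by
  rw [jumpVec, if_neg (lt_irrefl _)]
  refine div_pos ?_ (by positivity)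
  have e := eig_rec (n := n) (q := 1) (m := n + 2) (by omega)
  have h : eig n 1 (n + 1) ≤ ∑ j ∈ Finset.range n, eig n 1 (n + 2 - 1 - j) :=
    Finset.single_le_sum (f := fun j => eig n 1 (n + 2 - 1 - j))
      (fun j _ => eig_nonneg _ _ _) (Finset.mem_range.2 hn)
  rw [eig_one_eq_one (by omega) le_rfl] at h
  rw [show ((n + 2 : ℕ) : ℝ) - (1 : ℕ) = n + 1 by push_cast; ring, Nat.cast_one, one_mul] at e
  exact pos_of_mul_pos_right (a := (n : ℝ) + 1) (by linarith) (by positivity)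

/-- The two one-sided limits at `1 / 2` are `avg 1 (eig n 1)` and `avg (n + 1) (Pi.single 1 1)`. -/
lemma avg_eig_one_eq (n m : ℕ) :
    avg 1 (eig n 1) m = avg (n + 1) (Pi.single 1 1) m + jumpVec n m := by
  rcases Nat.eq_zero_or_pos m with rfl | h0
  · simp [jumpVec]
  rw [avg_one, jumpVec]
  split_ifs with h
  · have e : ∑ j ∈ Finset.range (n + 1), (Pi.single 1 1 : ℕ → ℝ) (m - j) = 1 := by
      rw [Finset.sum_eq_single (m - 1)]
      · rw [show m - (m - 1) = 1 by omega, Pi.single_eq_same]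
      · intro j _ hj
        exact Pi.single_eq_of_ne (by omega) _
      · intro hj
        exact absurd (Finset.mem_range.2 (by omega)) hj
    rw [eig_one_eq_one h0 (by omega), avg, e, add_zero]
  · rw [avg, Finset.sum_eq_zero fun j hj => ?_, zero_div, zero_add]
    have := Finset.mem_range.1 hj
    exact Pi.single_eq_of_ne (by omega) _

/-- The difference of the one-sided limits of `limVec n` at `dyad u`. -/
def wordVec (n : ℕ) : List Bool → ℕ → ℝ
  | [] => jumpVec n
  | false :: u => avg 1 (wordVec n u)
  | true :: u => avg (n + 1) (wordVec n u)

lemma wordVec_nonneg (n : ℕ) (u : List Bool) (m : ℕ) : 0 ≤ wordVec n u m := by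
  induction u generalizing m with
  | nil => exact jumpVec_nonneg n m
  | cons b u ih => cases b <;> exact avg_nonneg ih m

lemma wordVec_of_lt {n : ℕ} (u : List Bool) {m : ℕ} (h : m < n + 2) : wordVec n u m = 0 := by
  induction u generalizing m with
  | nil => exact if_pos h
  | cons b u ih => cases b <;> exact avg_of_lt (fun _ => ih) h

lemma wordVec_first (n : ℕ) (u : List Bool) :
    wordVec n u (n + 2) = jumpVec n (n + 2) * (1 / ((n : ℝ) + 2)) ^ u.length := by
  induction u with
  | nil => simp [wordVec]
  | cons b u ih =>
    have : wordVec n (b :: u) (n + 2) = wordVec n u (n + 2) / (n + 2 : ℕ) := by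
      cases b <;> exact avg_eq_of_first (by omega) (fun _ => wordVec_of_lt u) (by omega)
    rw [this, ih, List.length_cons, pow_succ]
    push_cast
    ring

lemma wordVec_le {n : ℕ} (hn : 1 ≤ n) (u : List Bool) (m : ℕ) :
    wordVec n u m ≤ (1 / ((n : ℝ) + 2)) ^ u.length * eig n (n + 2) m := by
  induction u generalizing m with
  | nil => simpa [wordVec] using jumpVec_le hn m
  | cons b u ih =>
    calc wordVec n (b :: u) m ≤ avg (n + 1) (wordVec n u) m := by
          cases b
          · exact avg_mono_width (by omega) (wordVec_nonneg n u) m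
          · exact le_rfl
      _ ≤ avg (n + 1) (fun i => (1 / ((n : ℝ) + 2)) ^ u.length * eig n (n + 2) i) m := avg_mono ih m
      _ = _ := by
          rw [avg_const_mul, avg_eig (by omega), List.length_cons, pow_succ]
          push_cast
          ring

/-- The ratio of the geometric decay of the jumps is summable over all words. -/
lemma summable_ratio_pow {n : ℕ} (hn : 1 ≤ n) :
    Summable fun u : List Bool => (1 / ((n : ℝ) + 2)) ^ u.length := by
  have : (1 : ℝ) ≤ n := by exact_mod_cast hn
  refine summable_pow_length (by positivity) ?_
  rw [mul_one_div, div_lt_one (by positivity)]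
  linarith

lemma summable_wordVec_prod {n : ℕ} (hn : 1 ≤ n) :
    Summable fun p : List Bool × ℕ => wordVec n p.1 p.2 :=
  ((summable_ratio_pow hn).mul_of_nonneg (summable_eig n (n + 2)) (fun _ => by positivity)
    (fun _ => eig_nonneg _ _ _)).of_nonneg_of_le (fun p => wordVec_nonneg n p.1 p.2)
    fun p => wordVec_le hn p.1 p.2

lemma summable_wordVec {n : ℕ} (hn : 1 ≤ n) (u : List Bool) : Summable (wordVec n u) :=
  (summable_wordVec_prod hn).prod_factor u

/-- The height of the jump of `F n` at `dyad u`. -/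
def jump (n : ℕ) (u : List Bool) : ℝ := ∑' m, wordVec n u m

lemma summable_jump {n : ℕ} (hn : 1 ≤ n) : Summable (jump n) :=
  (summable_wordVec_prod hn).prod

lemma le_jump {n : ℕ} (hn : 1 ≤ n) (u : List Bool) :
    jumpVec n (n + 2) * (1 / ((n : ℝ) + 2)) ^ u.length ≤ jump n u := by
  rw [← wordVec_first]
  exact (summable_wordVec hn u).le_tsum _ fun m _ => wordVec_nonneg n u m

lemma jump_le {n : ℕ} (hn : 1 ≤ n) (u : List Bool) :
    jump n u ≤ (∑' m, eig n (n + 2) m) * (1 / ((n : ℝ) + 2)) ^ u.length := by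
  rw [mul_comm, ← tsum_mul_left]
  exact (summable_wordVec hn u).tsum_le_tsum (wordVec_le hn u)
    ((summable_eig n (n + 2)).mul_left _)

lemma jump_pos {n : ℕ} (hn : 1 ≤ n) (u : List Bool) : 0 < jump n u :=
  (mul_pos (jumpVec_first_pos hn) (by positivity)).trans_le (le_jump hn u)

/-! ### Sums over the dyadic points to the left of a point -/

/-- The sum of the weights `f u` of the dyadic points `dyad u < x`. -/
def sumBelow (f : List Bool → ℝ) (x : ℝ) : ℝ := ∑' u, if dyad u < x then f u else 0

lemma summable_ite {f : List Bool → ℝ} (hf : Summable f) (h0 : ∀ u, 0 ≤ f u) (p : List Bool → Prop)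
    [DecidablePred p] : Summable fun u => if p u then f u else 0 :=
  hf.of_nonneg_of_le (fun u => by split_ifs <;> simp [h0]) fun u => by split_ifs <;> simp [h0]

lemma sumBelow_one (f : List Bool → ℝ) : sumBelow f 1 = ∑' u, f u :=
  tsum_congr fun u => if_pos (dyad_mem u).2

lemma sumBelow_nonneg {f : List Bool → ℝ} (h0 : ∀ u, 0 ≤ f u) (x : ℝ) : 0 ≤ sumBelow f x :=
  tsum_nonneg fun u => by split_ifs <;> simp [h0]

lemma sumBelow_half {f : List Bool → ℝ} (hf : Summable f) (h0 : ∀ u, 0 ≤ f u) {x : ℝ}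
    (hx : x ∈ Ioc (0 : ℝ) 1) : sumBelow f (x / 2) = sumBelow (fun u => f (false :: u)) x := by
  rw [sumBelow, tsum_word (summable_ite hf h0 _), if_neg, zero_add]
  · have h1 : ∀ u, ¬ dyad (true :: u) < x / 2 := fun u => by
      simp only [dyad]
      linarith [(dyad_mem u).1, hx.2]
    have h2 : ∀ u, dyad (false :: u) < x / 2 ↔ dyad u < x := fun u => by
      simp only [dyad]; constructor <;> intro h <;> linarith
    simp only [h1, h2, if_false, tsum_zero, add_zero]
    rfl
  · simp only [dyad]
    linarith [hx.2]

lemma sumBelow_half_add {f : List Bool → ℝ} (hf : Summable f) (h0 : ∀ u, 0 ≤ f u) {x : ℝ}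
    (hx : x ∈ Ioc (0 : ℝ) 1) : sumBelow f ((1 + x) / 2) =
      f [] + (sumBelow (fun u => f (false :: u)) 1 + sumBelow (fun u => f (true :: u)) x) := by
  rw [sumBelow, tsum_word (summable_ite hf h0 _), if_pos, sumBelow_one]
  · congr 2
    · refine tsum_congr fun u => if_pos ?_
      simp only [dyad]
      linarith [(dyad_mem u).2, hx.1]
    · exact tsum_congr fun u => by
        have : dyad (true :: u) < (1 + x) / 2 ↔ dyad u < x := by
          simp only [dyad]; constructor <;> intro h <;> linarith
        simp only [this]
  · simp only [dyad]
    linarith [hx.1]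

/-- The increment of `sumBelow f` is the sum of the weights of the dyadic points in `[x, y)`. -/
lemma sumBelow_sub {f : List Bool → ℝ} (hf : Summable f) (h0 : ∀ u, 0 ≤ f u) {x y : ℝ}
    (hxy : x ≤ y) :
    sumBelow f y - sumBelow f x = ∑' u, if x ≤ dyad u ∧ dyad u < y then f u else 0 := by
  rw [sumBelow, sumBelow, ← (summable_ite hf h0 _).tsum_sub (summable_ite hf h0 _)]
  refine tsum_congr fun u => ?_
  by_cases h1 : dyad u < x
  · simp [h1, h1.trans_le hxy]
  · simp [h1, not_lt.1 h1]

lemma le_sumBelow_sub {f : List Bool → ℝ} (hf : Summable f) (h0 : ∀ u, 0 ≤ f u) {x y : ℝ}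
    (u : List Bool) (h1 : x ≤ dyad u) (h2 : dyad u < y) :
    f u ≤ sumBelow f y - sumBelow f x := by
  rw [sumBelow_sub hf h0 (h1.trans h2.le)]
  have := (summable_ite hf h0 fun u => x ≤ dyad u ∧ dyad u < y).le_tsum u
    fun v _ => by split_ifs <;> simp [h0]
  simpa [h1, h2] using this

lemma sumBelow_strictMonoOn {f : List Bool → ℝ} (hf : Summable f) (h0 : ∀ u, 0 < f u) :
    StrictMonoOn (sumBelow f) (Ioc 0 1) := by
  intro x hx y hy hxy
  obtain ⟨u, h1, h2⟩ := exists_dyad_mem hx hy hxy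
  have := le_sumBelow_sub hf (fun u => (h0 u).le) u h1 h2
  linarith [h0 u]

lemma sumBelow_pos {f : List Bool → ℝ} (hf : Summable f) (h0 : ∀ u, 0 < f u) {x : ℝ}
    (hx : x ∈ Ioc (0 : ℝ) 1) : 0 < sumBelow f x :=
  (sumBelow_nonneg (fun u => (h0 u).le) _).trans_lt
    (sumBelow_strictMonoOn hf h0 (half_mem hx) hx (by linarith [hx.1]))

lemma sumBelow_le_one {f : List Bool → ℝ} (hf : Summable f) (h0 : ∀ u, 0 ≤ f u) (x : ℝ) :
    sumBelow f x ≤ sumBelow f 1 := by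
  rw [sumBelow_one]
  exact (summable_ite hf h0 _).tsum_le_tsum (fun u => by split_ifs <;> simp [h0]) hf

/-- The increments of `sumBelow` compare as the weights do. -/
lemma sumBelow_sub_le {f g : List Bool → ℝ} (hf : Summable f) (hg : Summable g)
    (h0 : ∀ u, 0 ≤ f u) (hfg : ∀ u, f u ≤ g u) {x y : ℝ} (hxy : x ≤ y) :
    sumBelow f y - sumBelow f x ≤ sumBelow g y - sumBelow g x := by
  rw [sumBelow_sub hf h0 hxy, sumBelow_sub hg (fun u => (h0 u).trans (hfg u)) hxy]
  exact (summable_ite hf h0 _).tsum_le_tsum (fun u => by split_ifs <;> simp [hfg])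
    (summable_ite hg (fun u => (h0 u).trans (hfg u)) _)

lemma sumBelow_const_mul (c : ℝ) (f : List Bool → ℝ) (x : ℝ) :
    sumBelow (fun u => c * f u) x = c * sumBelow f x := by
  rw [sumBelow, sumBelow, ← tsum_mul_left]
  exact tsum_congr fun u => by split_ifs <;> simp

lemma continuousAt_sumBelow {f : List Bool → ℝ} (hf : Summable f) (h0 : ∀ u, 0 ≤ f u) {x : ℝ}
    (hx : x ∉ range dyad) : ContinuousAt (sumBelow f) x := by
  refine tendsto_tsum_of_dominated_convergence hf (fun u => ?_) (Eventually.of_forall fun y u => ?_)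
  · rcases lt_trichotomy (dyad u) x with h | h | h
    · refine Tendsto.congr' ?_ tendsto_const_nhds
      filter_upwards [lt_mem_nhds h] with y hy
      simp [h, hy]
    · exact absurd ⟨u, h⟩ hx
    · refine Tendsto.congr' ?_ tendsto_const_nhds
      filter_upwards [gt_mem_nhds h] with y hy
      simp [h.not_gt, hy.not_gt]
  · rw [Real.norm_of_nonneg (by split_ifs <;> simp [h0])]
    split_ifs <;> simp [h0]

lemma not_continuousWithinAt_sumBelow {f : List Bool → ℝ} (hf : Summable f) (h0 : ∀ u, 0 < f u)
    (u : List Bool) : ¬ ContinuousWithinAt (sumBelow f) (Ioc 0 1) (dyad u) := by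
  intro h
  have h1 : Tendsto (sumBelow f) (𝓝[>] dyad u) (𝓝 (sumBelow f (dyad u))) := by
    refine h.mono_left (nhdsWithin_le_iff.2 ?_)
    filter_upwards [Ioc_mem_nhdsGT (dyad_mem u).2] with y hy
    exact ⟨(dyad_mem u).1.trans hy.1, hy.2⟩
  have h2 : sumBelow f (dyad u) + f u ≤ sumBelow f (dyad u) := by
    refine ge_of_tendsto h1 ?_
    filter_upwards [self_mem_nhdsWithin] with y hy
    linarith [le_sumBelow_sub hf (fun u => (h0 u).le) u le_rfl hy]
  linarith [h0 u]

/-! ### The continuous part -/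

lemma summable_wordVec_left {n : ℕ} (hn : 1 ≤ n) (m : ℕ) : Summable fun u => wordVec n u m :=
  (summable_wordVec_prod hn).prod_symm.prod_factor m

lemma sumBelow_avg {w : ℕ} {f : List Bool → ℕ → ℝ} (hf : ∀ m, Summable fun u => f u m)
    (h0 : ∀ u m, 0 ≤ f u m) (x : ℝ) (m : ℕ) :
    sumBelow (fun u => avg w (f u) m) x = avg w (fun i => sumBelow (fun u => f u i) x) m := by
  unfold sumBelow
  rw [avg_tsum w (u := fun u i => if dyad u < x then f u i else 0)
    fun i => summable_ite (hf i) (fun u => h0 u i) _]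
  refine tsum_congr fun u => ?_
  split_ifs <;> simp [avg]

/-- The accumulated jumps of the components of `limVec n` on `(0, x)`. -/
def jumpSum (n : ℕ) (x : ℝ) (m : ℕ) : ℝ := sumBelow (fun u => wordVec n u m) x

lemma jumpSum_nonneg (n : ℕ) (x : ℝ) (m : ℕ) : 0 ≤ jumpSum n x m :=
  sumBelow_nonneg (fun u => wordVec_nonneg n u m) x

lemma jumpSum_of_lt {n : ℕ} (x : ℝ) {m : ℕ} (h : m < n + 2) : jumpSum n x m = 0 := by
  simp [jumpSum, sumBelow, wordVec_of_lt _ h]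

lemma jumpSum_half {n : ℕ} (hn : 1 ≤ n) {x : ℝ} (hx : x ∈ Ioc (0 : ℝ) 1) (m : ℕ) :
    jumpSum n (x / 2) m = avg 1 (jumpSum n x) m := by
  rw [jumpSum, sumBelow_half (summable_wordVec_left hn m) (fun u => wordVec_nonneg n u m) hx]
  exact sumBelow_avg (summable_wordVec_left hn) (wordVec_nonneg n) x m

lemma jumpSum_half_add {n : ℕ} (hn : 1 ≤ n) {x : ℝ} (hx : x ∈ Ioc (0 : ℝ) 1) (m : ℕ) :
    jumpSum n ((1 + x) / 2) m =
      jumpVec n m + (avg 1 (jumpSum n 1) m + avg (n + 1) (jumpSum n x) m) := by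
  rw [jumpSum, sumBelow_half_add (summable_wordVec_left hn m) (fun u => wordVec_nonneg n u m) hx]
  congr 2
  · exact sumBelow_avg (summable_wordVec_left hn) (wordVec_nonneg n) 1 m
  · exact sumBelow_avg (summable_wordVec_left hn) (wordVec_nonneg n) x m

/-- The components of `limVec n`, made continuous by adding the accumulated jumps, and normalized
to vanish at `0`. -/
def contVec (n : ℕ) (x : ℝ) (m : ℕ) : ℝ :=
  limVec n x m - (Pi.single 1 1 : ℕ → ℝ) m + jumpSum n x m

lemma avg_contVec (n w : ℕ) (x : ℝ) (m : ℕ) :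
    avg w (contVec n x) m =
      avg w (limVec n x) m - avg w (Pi.single 1 1) m + avg w (jumpSum n x) m := by
  rw [← avg_sub, ← avg_add]
  rfl

lemma avg_one_single (m : ℕ) : avg 1 (Pi.single 1 1) m = (Pi.single 1 1 : ℕ → ℝ) m := by
  rw [avg_one]
  by_cases h : m = 1
  · simp [h]
  · simp [h]

lemma contVec_half {n : ℕ} (hn : 1 ≤ n) {x : ℝ} (hx : x ∈ Ioc (0 : ℝ) 1) (m : ℕ) :
    contVec n (x / 2) m = avg 1 (contVec n x) m := by
  rw [avg_contVec, contVec, limVec_half n hx, jumpSum_half hn hx, avg_one_single]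

/-- The contribution of the jump at `1 / 2` cancels the discontinuity of `limVec n` there. -/
lemma contVec_half_add {n : ℕ} (hn : 1 ≤ n) {x : ℝ} (hx : x ∈ Ioc (0 : ℝ) 1) (m : ℕ) :
    contVec n ((1 + x) / 2) m = avg (n + 1) (contVec n x) m + avg 1 (contVec n 1) m := by
  rw [avg_contVec, avg_contVec, contVec, limVec_half_add n hx, jumpSum_half_add hn hx,
    avg_one_single, show limVec n 1 = eig n 1 from funext (limVec_one n), avg_eig_one_eq]
  ring

lemma contVec_one_eq {n : ℕ} (hn : 1 ≤ n) (m : ℕ) :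
    contVec n 1 m = avg (n + 1) (contVec n 1) m + avg 1 (contVec n 1) m := by
  have := contVec_half_add hn one_mem_Ioc m
  norm_num at this
  exact this

lemma contVec_nonneg (n : ℕ) (x : ℝ) (m : ℕ) : 0 ≤ contVec n x m :=
  add_nonneg (sub_nonneg.2 (single_le_of (limVec_nonneg n x) (limVec_one_right n x) m))
    (jumpSum_nonneg n x m)

lemma contVec_le_one {n : ℕ} (hn : 1 ≤ n) (x : ℝ) (m : ℕ) :
    contVec n x m ≤ contVec n 1 m := by
  refine add_le_add (sub_le_sub_right ?_ _)
    (sumBelow_le_one (summable_wordVec_left hn m) (fun u => wordVec_nonneg n u m) x)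
  rw [limVec_one]
  exact limVec_le_eig n x m

lemma contVec_two {n : ℕ} (hn : 1 ≤ n) {x : ℝ} (hx : x ∈ Ioc (0 : ℝ) 1) : contVec n x 2 = x := by
  rw [contVec, limVec_two hn hx, jumpSum_of_lt x (by omega)]
  simp

/-- By `contVec_one_eq`, the vector `contVec n 1` satisfies the recursion of `eig n 2` with the
factor `1 / (m - 2)` in place of `2 / (m - 2)`. -/
lemma contVec_one_le_eig {n : ℕ} (hn : 1 ≤ n) (m : ℕ) : contVec n 1 m ≤ eig n 2 m := by
  induction m using Nat.strong_induction_on with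
  | _ m ih =>
  rcases Nat.lt_or_ge 2 m with hm | hm
  · have h2 : (2 : ℝ) < m := by exact_mod_cast hm
    have e1 := contVec_one_eq hn m
    rw [avg_succ, avg_one, ← add_div, eq_div_iff (by positivity)] at e1
    have e2 := eig_rec (n := n) (q := 2) (m := m) hm.le
    have h3 : ∑ j ∈ Finset.range n, contVec n 1 (m - 1 - j) ≤
        ∑ j ∈ Finset.range n, eig n 2 (m - 1 - j) :=
      Finset.sum_le_sum fun j _ => ih _ (by omega)
    have h4 : 0 ≤ ∑ j ∈ Finset.range n, eig n 2 (m - 1 - j) :=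
      Finset.sum_nonneg fun j _ => eig_nonneg _ _ _
    push_cast at e2
    refine le_of_mul_le_mul_left (a := (m : ℝ) - 2) ?_ (by linarith)
    linarith
  · interval_cases m
    · rw [eig_of_lt two_pos, contVec, limVec_zero_right, jumpSum_of_lt 1 (by omega)]
      simp
    · rw [eig_of_lt one_lt_two, contVec, limVec_one_right, jumpSum_of_lt 1 (by omega)]
      simp
    · rw [eig_self, contVec_two hn one_mem_Ioc]

/-- Two points separated by `1 / 2` are compared through `contVec n x ≤ contVec n 1` and
`0 ≤ contVec n y`; the general case is the image of this one under positive operators. -/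
lemma contVec_mono {n : ℕ} (hn : 1 ≤ n) {x y : ℝ} (hx : x ∈ Ioc (0 : ℝ) 1)
    (hy : y ∈ Ioc (0 : ℝ) 1) (hxy : x ≤ y) (m : ℕ) : contVec n x m ≤ contVec n y m := by
  rcases hxy.eq_or_lt with rfl | hxy
  · exact le_rfl
  revert m
  refine digit_induction (p := fun x y => ∀ m, contVec n x m ≤ contVec n y m) ?_ ?_ ?_ hx hy hxy
  · intro x hx y hy _ h m
    rw [contVec_half hn hx, contVec_half hn hy]
    exact avg_mono h m
  · intro x hx y hy _ h m
    rw [contVec_half_add hn hx, contVec_half_add hn hy]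
    exact add_le_add_left (avg_mono h m) _
  · intro x hx y hy m
    rw [contVec_half hn hx, contVec_half_add hn hy]
    exact (avg_mono (contVec_le_one hn x) m).trans
      (le_add_of_nonneg_left (avg_nonneg (contVec_nonneg n y) m))

lemma avg_le_geometric {n w k : ℕ} {c : ℝ} (hc : 0 ≤ c) (hw : w ≤ n + 1) {v : ℕ → ℝ}
    (h : ∀ m, v m ≤ c * (1 / 2) ^ k * eig n 2 m) (m : ℕ) :
    avg w v m ≤ c * (1 / 2) ^ (k + 1) * eig n 2 m := by
  have hpos : ∀ i, 0 ≤ c * (1 / 2) ^ k * eig n 2 i := fun i =>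
    mul_nonneg (by positivity) (eig_nonneg _ _ _)
  refine (avg_mono h m).trans ((avg_mono_width hw hpos m).trans ?_)
  rw [avg_const_mul, avg_eig one_le_two, pow_succ]
  push_cast
  linarith

lemma contVec_le_geometric {n : ℕ} (hn : 1 ≤ n) {k : ℕ} {x : ℝ} (hx : x ∈ Ioc (0 : ℝ) 1)
    (h : x ≤ (1 / 2) ^ k) (m : ℕ) : contVec n x m ≤ 1 * (1 / 2) ^ k * eig n 2 m := by
  induction k generalizing x m with
  | zero => simpa using (contVec_le_one hn x m).trans (contVec_one_le_eig hn m)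
  | succ k ih =>
    rw [pow_succ] at h
    have hk : (1 / 2 : ℝ) ^ k ≤ 1 := pow_le_one₀ (by norm_num) (by norm_num)
    obtain ⟨y, hy, rfl | rfl⟩ := exists_eq_half hx
    · rw [contVec_half hn hy]
      exact avg_le_geometric zero_le_one (by omega) (ih hy (by linarith)) m
    · linarith [hy.1]

lemma contVec_one_sub_le_geometric {n : ℕ} (hn : 1 ≤ n) {k : ℕ} {x : ℝ} (hx : x ∈ Ioc (0 : ℝ) 1)
    (h : 1 - x < (1 / 2) ^ k) (m : ℕ) :
    contVec n 1 m - contVec n x m ≤ 1 * (1 / 2) ^ k * eig n 2 m := by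
  induction k generalizing x m with
  | zero => simpa using (sub_le_self _ (contVec_nonneg n x m)).trans (contVec_one_le_eig hn m)
  | succ k ih =>
    rw [pow_succ] at h
    have hk : (1 / 2 : ℝ) ^ k ≤ 1 := pow_le_one₀ (by norm_num) (by norm_num)
    obtain ⟨y, hy, rfl | rfl⟩ := exists_eq_half hx
    · linarith [hy.2]
    · rw [contVec_half_add hn hy, contVec_one_eq hn, add_sub_add_right_eq_sub, ← avg_sub]
      exact avg_le_geometric zero_le_one le_rfl (ih hy (by linarith)) m

/-- If `1 / 2` separates `x` from `y`, both points are close to it, and the increment is bounded by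
the increments of `contVec n` near its end points `0` and `1`. -/
lemma contVec_sub_le_geometric {n : ℕ} (hn : 1 ≤ n) {k : ℕ} {x y : ℝ} (hx : x ∈ Ioc (0 : ℝ) 1)
    (hy : y ∈ Ioc (0 : ℝ) 1) (hxy : x ≤ y) (h : y - x < (1 / 2) ^ k) (m : ℕ) :
    contVec n y m - contVec n x m ≤ 2 * (1 / 2) ^ k * eig n 2 m := by
  induction k generalizing x y m with
  | zero =>
    have h1 := contVec_nonneg n x m
    have h2 := (contVec_le_one hn y m).trans (contVec_one_le_eig hn m)
    have h3 := eig_nonneg n 2 m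
    simp only [pow_zero]
    linarith
  | succ k ih =>
    rw [pow_succ] at h
    obtain ⟨a, ha, rfl | rfl⟩ := exists_eq_half hx <;>
      obtain ⟨b, hb, rfl | rfl⟩ := exists_eq_half hy
    · rw [contVec_half hn ha, contVec_half hn hb, ← avg_sub]
      exact avg_le_geometric zero_le_two (by omega) (ih ha hb (by linarith) (by linarith)) m
    · have h1 := avg_le_geometric (w := n + 1) zero_le_one le_rfl
        (contVec_le_geometric hn (k := k) hb (by linarith [ha.2])) m
      have h2 := avg_le_geometric (w := 1) zero_le_one (by omega)
        (contVec_one_sub_le_geometric hn (k := k) ha (by linarith [hb.1])) m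
      rw [avg_sub] at h2
      rw [contVec_half hn ha, contVec_half_add hn hb]
      linarith
    · linarith [ha.1, hb.2]
    · rw [contVec_half_add hn ha, contVec_half_add hn hb, add_sub_add_right_eq_sub, ← avg_sub]
      exact avg_le_geometric zero_le_two le_rfl (ih ha hb (by linarith) (by linarith)) m

/-- The continuous part of the decomposition, up to an additive constant. -/
def contPart (n : ℕ) (x : ℝ) : ℝ := ∑' m, contVec n x m

lemma summable_contVec {n : ℕ} (hn : 1 ≤ n) (x : ℝ) : Summable (contVec n x) :=
  (summable_eig n 2).of_nonneg_of_le (contVec_nonneg n x)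
    fun m => (contVec_le_one hn x m).trans (contVec_one_le_eig hn m)

lemma contPart_nonneg (n : ℕ) (x : ℝ) : 0 ≤ contPart n x := tsum_nonneg (contVec_nonneg n x)

lemma contPart_strictMonoOn {n : ℕ} (hn : 1 ≤ n) : StrictMonoOn (contPart n) (Ioc 0 1) := by
  intro x hx y hy hxy
  refine (summable_contVec hn x).tsum_lt_tsum (i := 2) (contVec_mono hn hx hy hxy.le) ?_
    (summable_contVec hn y)
  rwa [contVec_two hn hx, contVec_two hn hy]

lemma contPart_le_one {n : ℕ} (hn : 1 ≤ n) (x : ℝ) : contPart n x ≤ contPart n 1 :=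
  (summable_contVec hn x).tsum_le_tsum (contVec_le_one hn x) (summable_contVec hn 1)

lemma continuousOn_contPart {n : ℕ} (hn : 1 ≤ n) : ContinuousOn (contPart n) (Ioc 0 1) := by
  have key : ∀ k : ℕ, ∀ x ∈ Ioc (0 : ℝ) 1, ∀ y ∈ Ioc (0 : ℝ) 1, x ≤ y → y - x < (1 / 2) ^ k →
      |contPart n y - contPart n x| ≤ (1 / 2) ^ k * (2 * ∑' m, eig n 2 m) := by
    intro k x hx y hy hxy h
    rw [abs_of_nonneg (sub_nonneg.2 ((contPart_strictMonoOn hn).monotoneOn hx hy hxy)), contPart,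
      contPart, ← (summable_contVec hn y).tsum_sub (summable_contVec hn x)]
    refine (((summable_contVec hn y).sub (summable_contVec hn x)).tsum_le_tsum
      (contVec_sub_le_geometric hn hx hy hxy h) ((summable_eig n 2).mul_left _)).trans_eq ?_
    rw [tsum_mul_left]
    ring
  intro x hx
  rw [Metric.continuousWithinAt_iff]
  intro ε hε
  have h0 : Tendsto (fun k : ℕ => (1 / 2 : ℝ) ^ k * (2 * ∑' m, eig n 2 m)) atTop (𝓝 0) := by
    simpa using (tendsto_pow_atTop_nhds_zero_of_lt_one (r := (1 / 2 : ℝ)) (by norm_num)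
      (by norm_num)).mul_const (2 * ∑' m, eig n 2 m)
  obtain ⟨k, hk⟩ := (h0.eventually (gt_mem_nhds hε)).exists
  refine ⟨(1 / 2) ^ k, by positivity, fun {y} hy hd => ?_⟩
  rw [Real.dist_eq] at hd ⊢
  refine lt_of_le_of_lt ?_ hk
  rcases le_total x y with h | h
  · exact key k x hx y hy h (abs_lt.1 hd).2
  · rw [abs_sub_comm]
    exact key k y hy x hx h (by rw [abs_sub_comm] at hd; exact (abs_lt.1 hd).2)

/-- Up to a constant, `∑' m, limVec n x m` is the difference of the continuous part and the sum of
the jumps. -/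
lemma tsum_limVec_eq {n : ℕ} (hn : 1 ≤ n) (x : ℝ) :
    ∑' m, limVec n x m = contPart n x + 1 - sumBelow (jump n) x := by
  have hs : Summable fun p : List Bool × ℕ => if dyad p.1 < x then wordVec n p.1 p.2 else 0 :=
    (summable_wordVec_prod hn).of_nonneg_of_le
      (fun p => by split_ifs <;> simp [wordVec_nonneg])
      (fun p => by split_ifs <;> simp [wordVec_nonneg])
  have hJ : Summable (jumpSum n x) := hs.prod_symm.prod
  have h1 : ∑' m, jumpSum n x m = sumBelow (jump n) x := by
    have := hs.tsum_comm (f := fun u m => if dyad u < x then wordVec n u m else 0)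
    refine this.trans (tsum_congr fun u => ?_)
    split_ifs
    · rfl
    · exact tsum_zero
  have h2 := ((summable_limVec n x).hasSum.sub (hasSum_pi_single 1 (1 : ℝ))).add hJ.hasSum
  rw [h1] at h2
  rw [contPart, show contVec n x = _ from rfl]
  unfold contVec
  rw [h2.tsum_eq]
  ring

/-! ### The integrals over the cube -/

lemma setIntegral_cube_succ {N : ℕ} {f : (Fin (N + 1) → ℝ) → ℝ} (hf : Continuous f) :
    ∫ y in Icc (0 : Fin (N + 1) → ℝ) 1, f y =
      ∫ a in Icc (0 : ℝ) 1, ∫ y in Icc (0 : Fin N → ℝ) 1, f (Fin.cons a y) := by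
  set e : ℝ × (Fin N → ℝ) ≃ᵐ (Fin (N + 1) → ℝ) :=
    (MeasurableEquiv.piFinSuccAbove (fun _ => ℝ) 0).symm
  have hem : MeasurePreserving e :=
    (volume_preserving_piFinSuccAbove (fun _ : Fin (N + 1) => ℝ) 0).symm _
  have he : ∀ p, e p = Fin.cons p.1 p.2 := fun p => by
    simp [e, MeasurableEquiv.piFinSuccAbove_symm_apply, Fin.insertNthEquiv]
  have hpre : e ⁻¹' Icc 0 1 = Icc (0 : ℝ) 1 ×ˢ Icc (0 : Fin N → ℝ) 1 := by
    ext p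
    simp only [mem_preimage, he, mem_Icc, mem_prod, Pi.le_def, Fin.forall_fin_succ, Fin.cons_zero,
      Fin.cons_succ, Pi.zero_apply, Pi.one_apply]
    tauto
  rw [← hem.map_eq, setIntegral_map_equiv, hpre, Measure.volume_eq_prod, setIntegral_prod]
  · simp only [he]
  · refine ContinuousOn.integrableOn_compact (isCompact_Icc.prod isCompact_Icc) ?_
    simp only [he]
    fun_prop

/-- The integrand of `T`, as a function of the point `x` of `(0, 1]` that encodes the sequence;
the factor `t` is the product of the coordinates that have been integrated out. -/
def weight (n : ℕ) : (N : ℕ) → ℝ → ℝ → (Fin N → ℝ) → ℝ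
  | 0, _, _, _ => 1
  | N + 1, x, t, y =>
    (∑ j ∈ Finset.range (width n x), (t * y 0) ^ j) * weight n N (dbl x) (t * y 0) (Fin.tail y)

lemma continuous_weight (n N : ℕ) (x : ℝ) :
    Continuous fun p : ℝ × (Fin N → ℝ) => weight n N x p.1 p.2 := by
  induction N generalizing x with
  | zero => exact continuous_const
  | succ N ih =>
    refine Continuous.mul (by fun_prop) ?_
    have h : Continuous fun p : ℝ × (Fin (N + 1) → ℝ) => (p.1 * p.2 0, Fin.tail p.2) := by
      unfold Fin.tail
      fun_prop
    exact (ih (dbl x)).comp h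

lemma sum_shift {v : ℕ → ℝ} {M j : ℕ} (h0 : v 0 = 0) (hv : ∀ m, M ≤ m + j → v m = 0) (s : ℝ) :
    s ^ j * ∑ m ∈ Finset.range M, v m * s ^ (m - 1) =
      ∑ m ∈ Finset.range M, v (m - j) * s ^ (m - 1) := by
  rcases le_or_gt M j with h | h
  · rw [Finset.sum_eq_zero fun m _ => by rw [hv m (by omega), zero_mul],
      Finset.sum_eq_zero fun m hm => ?_, mul_zero]
    have := Finset.mem_range.1 hm
    rw [show m - j = 0 by omega, h0, zero_mul]
  · obtain ⟨i, rfl⟩ := Nat.exists_eq_add_of_le h.le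
    rw [Finset.sum_range_add (fun m => v (m - j) * s ^ (m - 1)),
      Finset.sum_eq_zero (s := Finset.range j) fun m hm => by
        have := Finset.mem_range.1 hm
        rw [show m - j = 0 by omega, h0, zero_mul],
      zero_add, Finset.mul_sum, add_comm j i, Finset.sum_range_add,
      Finset.sum_eq_zero (s := Finset.range j) fun m _ => by
        rw [hv (i + m) (by omega), zero_mul, mul_zero], add_zero]
    refine Finset.sum_congr rfl fun m _ => ?_
    rcases Nat.eq_zero_or_pos m with rfl | hm
    · simp [h0]
    · rw [show j + m - j = m by omega, show j + m - 1 = j + (m - 1) by omega, pow_add]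
      ring

lemma setIntegral_pow {m : ℕ} (hm : 1 ≤ m) : ∫ a in Icc (0 : ℝ) 1, a ^ (m - 1) = 1 / m := by
  rw [integral_Icc_eq_integral_Ioc, ← intervalIntegral.integral_of_le zero_le_one, integral_pow,
    Nat.sub_add_cancel hm, one_pow, zero_pow (by omega), Nat.cast_sub hm]
  simp

/-- The inner integral is a polynomial in the product `t` of the previous coordinates, whose
coefficients are the components of `partialVec n N x`. -/
lemma setIntegral_weight (n : ℕ) {N M : ℕ} (hM : n * N + 1 < M) (x t : ℝ) :
    ∫ y in Icc (0 : Fin N → ℝ) 1, weight n N x t y =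
      ∑ m ∈ Finset.range M, partialVec n N x m * t ^ (m - 1) := by
  induction N generalizing x t with
  | zero =>
    rw [Finset.sum_eq_single 1]
    · have hv : volume.real (Icc (0 : Fin 0 → ℝ) 1) = 1 := by
        rw [Measure.real, Real.volume_Icc_pi]
        simp
      simp only [weight, setIntegral_const, hv, partialVec]
      simp
    · intro m _ hm
      simp [partialVec, hm]
    · intro h
      exact absurd (Finset.mem_range.2 (by omega)) h
  | succ N ih =>
    rw [Nat.mul_succ] at hM
    have hcont : Continuous fun y => weight n (N + 1) x t y :=
      (continuous_weight n (N + 1) x).comp (by fun_prop : Continuous fun y => (t, y))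
    rw [setIntegral_cube_succ hcont]
    have h1 : ∀ a : ℝ, ∫ y in Icc (0 : Fin N → ℝ) 1, weight n (N + 1) x t (Fin.cons a y) =
        ∑ m ∈ Finset.range M, ((∑ j ∈ Finset.range (width n x), partialVec n N (dbl x) (m - j)) *
          t ^ (m - 1)) * a ^ (m - 1) := by
      intro a
      simp only [weight, Fin.cons_zero, Fin.tail_cons]
      rw [integral_const_mul, ih (by omega), Finset.sum_mul,
        Finset.sum_congr rfl fun j hj => sum_shift (partialVec_zero_right n N (dbl x))
          (fun m hm => partialVec_eq_zero n (dbl x) ?_) (t * a), Finset.sum_comm]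
      · refine Finset.sum_congr rfl fun m _ => ?_
        rw [← Finset.sum_mul, mul_pow, mul_assoc]
      · have := Finset.mem_range.1 hj
        have := width_le n x
        omega
    simp only [h1]
    rw [integral_finsetSum _ fun m _ =>
      ContinuousOn.integrableOn_compact isCompact_Icc (by fun_prop)]
    refine Finset.sum_congr rfl fun m _ => ?_
    rw [integral_const_mul]
    rcases Nat.eq_zero_or_pos m with rfl | hm
    · simp [partialVec_zero_right]
    · rw [setIntegral_pow hm, partialVec, avg]
      ring

/-! ### Binary expansions -/

/-- The sequence `p, k 0, k 1, …`. -/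
def consSeq (p : ℕ+) (k : PosSeq) : PosSeq
  | 0 => p
  | i + 1 => k i

lemma consSeq_tail (k : PosSeq) : consSeq (k 0) (fun i => k (i + 1)) = k := by
  funext i; cases i <;> rfl

/-- A sequence starts with `1`, or it arises from another one by increasing its first entry. -/
lemma posSeq_cases (k : PosSeq) :
    (∃ k', k = consSeq 1 k') ∨ ∃ p k', k = consSeq (p + 1) k' := by
  rw [← consSeq_tail k]
  refine PNat.recOn (k 0) (Or.inl ⟨_, rfl⟩) fun p _ => Or.inr ⟨p, _, rfl⟩

lemma psum_zero (k : PosSeq) : psum k 0 = 0 := rfl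

lemma psum_consSeq (p : ℕ+) (k : PosSeq) (r : ℕ) : psum (consSeq p k) (r + 1) = p + psum k r := by
  rw [psum, Finset.sum_range_succ', add_comm]
  rfl

lemma le_psum (k : PosSeq) (r : ℕ) : r ≤ psum k r := by
  simpa [psum] using Finset.card_nsmul_le_sum (Finset.range r) (fun i => (k i : ℕ)) 1
    fun i _ => (k i).pos

lemma summable_tau (k : PosSeq) : Summable fun r : ℕ => 1 / (2 : ℝ) ^ psum k (r + 1) := by
  refine (summable_geometric_of_lt_one (by norm_num)
    (by norm_num : (1 / 2 : ℝ) < 1)).of_nonneg_of_le (fun r => by positivity) fun r => ?_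
  rw [one_div_pow]
  exact one_div_le_one_div_of_le (by positivity)
    (pow_le_pow_right₀ one_le_two ((Nat.le_succ r).trans (le_psum k _)))

lemma tau_consSeq (p : ℕ+) (k : PosSeq) : tau (consSeq p k) = (1 + tau k) / 2 ^ (p : ℕ) := by
  rw [tau, (summable_tau _).tsum_eq_zero_add, psum_consSeq, psum_zero, add_div, tau,
    ← tsum_div_const]
  congr 1
  refine tsum_congr fun r => ?_
  rw [psum_consSeq, pow_add, div_div, mul_comm]

lemma tau_pos (k : PosSeq) : 0 < tau k :=
  (summable_tau k).tsum_pos (fun r => by positivity) 0 (by positivity)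

lemma tau_le_one (k : PosSeq) : tau k ≤ 1 := by
  have h : HasSum (fun r : ℕ => 1 / (2 : ℝ) ^ (r + 1)) 1 := by
    simpa [div_eq_mul_inv, pow_succ, mul_comm] using hasSum_geometric_two' 1
  rw [← h.tsum_eq]
  refine (summable_tau k).tsum_le_tsum (fun r => ?_) h.summable
  exact one_div_le_one_div_of_le (by positivity) (pow_le_pow_right₀ one_le_two (le_psum k _))

lemma tau_mem (k : PosSeq) : tau k ∈ Ioc (0 : ℝ) 1 := ⟨tau_pos k, tau_le_one k⟩

lemma tau_consSeq_one (k : PosSeq) : tau (consSeq 1 k) = (1 + tau k) / 2 := by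
  simp [tau_consSeq]

lemma tau_consSeq_succ (p : ℕ+) (k : PosSeq) :
    tau (consSeq (p + 1) k) = tau (consSeq p k) / 2 := by
  rw [tau_consSeq, tau_consSeq, PNat.add_coe, PNat.one_coe, pow_succ, div_div]

lemma tau_injective : Function.Injective tau := by
  have h0 : ∀ p q : ℕ+, ∀ k l : PosSeq, p < q → tau (consSeq p k) ≠ tau (consSeq q l) := by
    intro p q k l hpq h
    rw [tau_consSeq, tau_consSeq, div_eq_div_iff (by positivity) (by positivity)] at h
    have h1 : (2 : ℝ) ^ (p : ℕ) * 2 ≤ 2 ^ (q : ℕ) := by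
      rw [← pow_succ]
      exact pow_le_pow_right₀ one_le_two (by exact_mod_cast hpq)
    have h2 : (0 : ℝ) < 2 ^ (p : ℕ) := by positivity
    have := mul_le_mul_of_nonneg_right (tau_le_one l) h2.le
    have := mul_pos (tau_pos k) (h2.trans_le (by linarith : (2 : ℝ) ^ (p : ℕ) ≤ 2 ^ (q : ℕ)))
    nlinarith
  have h1 : ∀ k l : PosSeq, tau k = tau l →
      k 0 = l 0 ∧ tau (fun i => k (i + 1)) = tau (fun i => l (i + 1)) := by
    intro k l h
    rw [← consSeq_tail k, ← consSeq_tail l] at h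
    have e : k 0 = l 0 := by
      rcases lt_trichotomy (k 0) (l 0) with h' | h' | h'
      · exact absurd h (h0 _ _ _ _ h')
      · exact h'
      · exact absurd h.symm (h0 _ _ _ _ h')
    refine ⟨e, ?_⟩
    rw [tau_consSeq, tau_consSeq, e, div_left_inj' (by positivity)] at h
    linarith
  intro k l h
  funext i
  induction i generalizing k l with
  | zero => exact (h1 k l h).1
  | succ i ih => exact ih (h1 k l h).2

lemma exists_pos_entry {x : ℝ} (hx : x ∈ Ioc (0 : ℝ) 1) :
    ∃ (p : ℕ+) (y : ℝ), y ∈ Ioc (0 : ℝ) 1 ∧ x = (1 + y) / 2 ^ (p : ℕ) := by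
  obtain ⟨L, hL⟩ := exists_pow_lt_of_lt_one hx.1 (by norm_num : (1 / 2 : ℝ) < 1)
  induction L generalizing x with
  | zero => simp at hL; linarith [hx.2]
  | succ L ih =>
    rw [pow_succ] at hL
    obtain ⟨y, hy, rfl | rfl⟩ := exists_eq_half hx
    · obtain ⟨p, z, hz, rfl⟩ := ih hy (by linarith)
      exact ⟨p + 1, z, hz, by rw [PNat.add_coe, PNat.one_coe, pow_succ, div_div]⟩
    · exact ⟨1, y, hy, by simp⟩

lemma tau_surjOn : SurjOn tau univ (Ioc 0 1) := by
  choose! p f hf hp using fun (x : ℝ) (hx : x ∈ Ioc (0 : ℝ) 1) => exists_pos_entry hx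
  intro x hx
  -- The entries of the preimage of `x` are read off along the orbit of `x` under `f`.
  refine ⟨fun i => p (f^[i] x), mem_univ _, ?_⟩
  have hmem : ∀ i, f^[i] x ∈ Ioc (0 : ℝ) 1 := fun i => by
    induction i with
    | zero => exact hx
    | succ i ih => rw [Function.iterate_succ_apply']; exact hf _ ih
  have key : ∀ L y, y ∈ Ioc (0 : ℝ) 1 → (∀ i, f^[i] y ∈ Ioc (0 : ℝ) 1) →
      |tau (fun i => p (f^[i] y)) - y| ≤ (1 / 2) ^ L := by
    intro L
    induction L with
    | zero =>
      intro y hy _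
      have := tau_mem fun i => p (f^[i] y)
      simp only [pow_zero, abs_le]
      constructor <;> linarith [this.1, this.2, hy.1, hy.2]
    | succ L ih =>
      intro y hy hm
      have h1 := ih (f y) (hf y hy) fun i => hm (i + 1)
      have h2 : (2 : ℝ) ≤ 2 ^ (p y : ℕ) :=
        le_self_pow₀ one_le_two (p y).pos.ne'
      rw [← consSeq_tail (fun i => p (f^[i] y)), tau_consSeq]
      simp only [Function.iterate_zero, id_eq, Function.iterate_succ_apply]
      nth_rewrite 3 [hp y hy]
      rw [← sub_div, add_sub_add_left_eq_sub, abs_div, 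
        abs_of_pos (by positivity : (0 : ℝ) < 2 ^ (p y : ℕ)),
        pow_succ, mul_one_div]
      exact div_le_div₀ (by positivity) h1 two_pos h2
  have h0 : Tendsto (fun L : ℕ => (1 / 2 : ℝ) ^ L) atTop (𝓝 0) :=
    tendsto_pow_atTop_nhds_zero_of_lt_one (by norm_num) (by norm_num)
  exact sub_eq_zero.1 (abs_nonpos_iff.1 (ge_of_tendsto' h0 fun L => key L x hx hmem))

lemma tau_bijOn : BijOn tau univ (Ioc 0 1) :=
  ⟨fun k _ => tau_mem k, tau_injective.injOn, tau_surjOn⟩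

lemma tau_const_one : tau (fun _ => 1) = 1 := by
  have := tau_consSeq_one fun _ => 1
  rw [show consSeq 1 (fun _ => 1) = fun _ => 1 from consSeq_tail fun _ => 1] at this
  linarith

lemma consSeq_mem_seqR {p : ℕ+} {k : PosSeq} (hk : k ∈ SeqR) : consSeq p k ∈ SeqR := by
  obtain ⟨s, h1, h2⟩ := hk
  refine ⟨s + 1, h1, fun i hi => ?_⟩
  obtain ⟨i, rfl⟩ := Nat.exists_eq_add_of_lt hi
  exact h2 _ (by omega)

lemma tau_mem_range_dyad {k : PosSeq} (hk : k ∈ SeqR) : tau k ∈ range dyad := by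
  have hcons : ∀ (k : PosSeq), tau k ∈ range dyad → ∀ p, tau (consSeq p k) ∈ range dyad := by
    rintro k ⟨u, hu⟩ p
    refine PNat.recOn p ?_ fun p ih => ?_
    · exact ⟨true :: u, by rw [tau_consSeq_one, ← hu]; rfl⟩
    · obtain ⟨v, hv⟩ := ih
      exact ⟨false :: v, by rw [tau_consSeq_succ, ← hv]; rfl⟩
  obtain ⟨s, h1, h2⟩ := hk
  induction s generalizing k with
  | zero =>
    have e : k = consSeq (k 0) fun _ => 1 := by
      conv_lhs => rw [← consSeq_tail k]
      congr 1
      funext i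
      exact h2 _ (Nat.succ_pos i)
    have hp : ∀ p : ℕ+, tau (consSeq (p + 1) fun _ => 1) ∈ range dyad := by
      intro p
      refine PNat.recOn p ?_ fun p ih => ?_
      · exact ⟨[], by rw [tau_consSeq_succ, tau_consSeq_one, tau_const_one]; norm_num [dyad]⟩
      · obtain ⟨v, hv⟩ := ih
        exact ⟨false :: v, by rw [tau_consSeq_succ, ← hv]; rfl⟩
    obtain ⟨p, hp'⟩ := PNat.exists_eq_succ_of_ne_one (n := k 0) (by
      intro h
      rw [h] at h1
      exact absurd h1 (by decide))
    rw [e, hp']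
    exact hp p
  | succ s ih =>
    rw [← consSeq_tail k]
    exact hcons _ (ih h1 fun i hi => h2 _ (by omega)) _

/-- The word of a dyadic number and its expansion with infinitely many digits `1` are compared digit
by digit; the empty word, for `1 / 2`, corresponds to the sequence `2, 1, 1, …`. -/
lemma mem_seqR_of_tau {k : PosSeq} (hk : tau k ∈ range dyad) : k ∈ SeqR := by
  obtain ⟨u, hu⟩ := hk
  induction u generalizing k with
  | nil =>
    have : k = consSeq (1 + 1) fun _ => 1 := tau_injective (by
      rw [tau_consSeq_succ, tau_consSeq_one, tau_const_one, ← hu]; norm_num [dyad])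
    rw [this]
    refine ⟨0, le_rfl, fun i hi => ?_⟩
    obtain ⟨i, rfl⟩ := Nat.exists_eq_succ_of_ne_zero hi.ne'
    rfl
  | cons b u ih =>
    have hu' := dyad_mem u
    rcases posSeq_cases k with ⟨k, rfl⟩ | ⟨p, k, rfl⟩
    · rw [tau_consSeq_one] at hu
      cases b
      · simp only [dyad] at hu
        linarith [hu'.2, tau_pos k]
      · simp only [dyad] at hu
        exact consSeq_mem_seqR (ih (by linarith))
    · rw [tau_consSeq_succ] at hu
      cases b
      · simp only [dyad] at hu
        obtain ⟨s, h1, h2⟩ := ih (k := consSeq p k) (by linarith)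
        refine ⟨s, ?_, fun i hi => ?_⟩
        · cases s
          · exact h1.trans (PNat.lt_add_right p 1).le
          · exact h1
        · have := h2 i hi
          cases i
          · omega
          · exact this
      · simp only [dyad] at hu
        linarith [hu'.1, tau_le_one (consSeq p k)]

lemma tau_image_seqR : tau '' SeqR = range dyad := by
  ext x
  constructor
  · rintro ⟨k, hk, rfl⟩
    exact tau_mem_range_dyad hk
  · rintro ⟨u, rfl⟩
    obtain ⟨k, -, hk⟩ := tau_surjOn (Ioo_subset_Ioc_self (dyad_mem u))
    exact ⟨k, mem_seqR_of_tau ⟨u, hk.symm⟩, hk⟩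

/-! ### The limits -/

lemma prod_filter_succ {N : ℕ} (c : ℕ) (y : Fin (N + 1) → ℝ) :
    ∏ l : Fin (N + 1) with l.val < c + 1, y l =
      y 0 * ∏ l : Fin N with l.val < c, Fin.tail y l := by
  rw [Finset.prod_filter, Fin.prod_univ_succ, Finset.prod_filter]
  simp [Fin.tail]

/-- The partial sums of `k` are the positions of the digits `1` of `tau k`, so that the product over
the blocks is the product over the digits. -/
lemma prod_eq_weight (n : ℕ) {N : ℕ} (k : PosSeq) (r : ℕ) (hN : N = psum k r) (t : ℝ)
    (y : Fin N → ℝ) :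
    ∏ i ∈ Finset.range r, ∑ j ∈ Finset.range (n + 1),
      (t * ∏ l : Fin N with l.val < psum k (i + 1), y l) ^ j = weight n N (tau k) t y := by
  induction N generalizing k r t with
  | zero =>
    have : r = 0 := by have := le_psum k r; omega
    subst this
    simp [weight]
  | succ N ih =>
    obtain ⟨r, rfl⟩ : ∃ r', r = r' + 1 :=
      Nat.exists_eq_succ_of_ne_zero (by rintro rfl; rw [psum_zero] at hN; omega)
    rw [weight]
    rcases posSeq_cases k with ⟨k, rfl⟩ | ⟨p, k, rfl⟩
    · rw [psum_consSeq, PNat.one_coe] at hN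
      rw [tau_consSeq_one, width_half_add n (tau_mem k), dbl_half_add (tau_mem k),
        ← ih k r (by omega), Finset.prod_range_succ', mul_comm]
      congr 1
      · have e : ∏ l : Fin (N + 1) with l.val < 1, y l = y 0 := by simpa using prod_filter_succ 0 y
        simp only [psum_consSeq, psum_zero, PNat.one_coe, add_zero, e]
      · refine Finset.prod_congr rfl fun i _ => ?_
        rw [psum_consSeq, PNat.one_coe, add_comm 1, prod_filter_succ, mul_assoc]
    · rw [psum_consSeq, PNat.add_coe, PNat.one_coe] at hN
      rw [tau_consSeq_succ, width_half n (tau_mem _), dbl_half (tau_mem _),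
        ← ih (consSeq p k) (r + 1) (by rw [psum_consSeq]; omega)]
      simp only [Finset.range_one, Finset.sum_singleton, pow_zero, one_mul]
      refine Finset.prod_congr rfl fun i _ => ?_
      rw [psum_consSeq, psum_consSeq, PNat.add_coe, PNat.one_coe, add_right_comm, prod_filter_succ,
        mul_assoc]

lemma T_eq_tsum (n : ℕ) (k : PosSeq) (r : ℕ) :
    T n k r = ∑' m, partialVec n (psum k r) (tau k) m := by
  have h : ∀ y : Fin (psum k r) → ℝ, _ := prod_eq_weight n k r rfl 1
  simp only [one_mul] at h
  simp only [T, h]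
  rw [setIntegral_weight n (Nat.lt_succ_self _), tsum_eq_sum fun m hm => ?_]
  · simp only [one_pow, mul_one]
    rfl
  · exact partialVec_eq_zero n _ (by simp at hm; omega)

lemma tendsto_T (n : ℕ) (k : PosSeq) :
    Tendsto (fun r => T n k r) atTop (𝓝 (∑' m, limVec n (tau k) m)) := by
  simp only [T_eq_tsum]
  exact (tendsto_tsum_partialVec n (tau k)).comp (tendsto_atTop_mono (le_psum k) tendsto_id)

lemma eta_eq (n : ℕ) (k : PosSeq) : eta n k = ∑' m, limVec n (tau k) m :=
  (tendsto_T n k).limUnder_eq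

lemma F_eq (n : ℕ) {x : ℝ} (hx : x ∈ Ioc (0 : ℝ) 1) : F n x = ∑' m, limVec n x m := by
  obtain ⟨k, -, rfl⟩ := tau_surjOn hx
  rw [F, Function.leftInverse_invFun tau_injective, eta_eq]

/-! ### The Cantor map -/

/-- The map that reads a binary expansion with infinitely many digits `1` as an expansion in base
`n + 2` with the digits `0` and `n + 1`, written as a sum over dyadic points. -/
def cantorMap (n : ℕ) (x : ℝ) : ℝ :=
  (n / ((n : ℝ) + 2)) * sumBelow (fun u => (1 / ((n : ℝ) + 2)) ^ u.length) x

lemma sumBelow_ratio_mul (n : ℕ) (x : ℝ) (b : Bool) :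
    sumBelow (fun u => (1 / ((n : ℝ) + 2)) ^ (b :: u).length) x =
      1 / ((n : ℝ) + 2) * sumBelow (fun u => (1 / ((n : ℝ) + 2)) ^ u.length) x := by
  rw [← sumBelow_const_mul]
  congr 1
  funext u
  rw [List.length_cons, pow_succ']

lemma cantorMap_half {n : ℕ} (hn : 1 ≤ n) {x : ℝ} (hx : x ∈ Ioc (0 : ℝ) 1) :
    cantorMap n (x / 2) = cantorMap n x / (n + 2) := by
  rw [cantorMap, sumBelow_half (summable_ratio_pow hn) (fun u => by positivity) hx,
    sumBelow_ratio_mul, cantorMap]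
  ring

lemma cantorMap_one {n : ℕ} (hn : 1 ≤ n) : cantorMap n 1 = 1 := by
  have e := sumBelow_half_add (summable_ratio_pow hn) (fun u => by positivity) one_mem_Ioc
  rw [sumBelow_ratio_mul, sumBelow_ratio_mul] at e
  norm_num at e
  have h1 : (1 : ℝ) ≤ n := by exact_mod_cast hn
  simp only [cantorMap, one_div, inv_pow]
  field_simp at e ⊢
  linarith

lemma cantorMap_half_add {n : ℕ} (hn : 1 ≤ n) {x : ℝ} (hx : x ∈ Ioc (0 : ℝ) 1) :
    cantorMap n ((1 + x) / 2) = (n + 1 + cantorMap n x) / (n + 2) := by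
  have e := cantorMap_one hn
  rw [cantorMap] at e
  rw [cantorMap, sumBelow_half_add (summable_ratio_pow hn) (fun u => by positivity) hx,
    sumBelow_ratio_mul, sumBelow_ratio_mul, cantorMap]
  have h2 : (n : ℝ) + 2 ≠ 0 := by positivity
  rw [mul_add, mul_add, mul_left_comm, e, List.length_nil, pow_zero]
  field_simp
  ring

lemma cantorMap_strictMonoOn {n : ℕ} (hn : 1 ≤ n) : StrictMonoOn (cantorMap n) (Ioc 0 1) := by
  have h1 : (0 : ℝ) < n := by exact_mod_cast hn
  intro x hx y hy hxy
  exact mul_lt_mul_of_pos_left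
    (sumBelow_strictMonoOn (summable_ratio_pow hn) (fun u => by positivity) hx hy hxy)
    (by positivity)

lemma cantorMap_mem {n : ℕ} (hn : 1 ≤ n) {x : ℝ} (hx : x ∈ Ioc (0 : ℝ) 1) :
    cantorMap n x ∈ Ioc (0 : ℝ) 1 := by
  have h1 : (0 : ℝ) < n := by exact_mod_cast hn
  refine ⟨mul_pos (by positivity)
    (sumBelow_pos (summable_ratio_pow hn) (fun u => by positivity) hx), ?_⟩
  rw [← cantorMap_one hn]
  exact (cantorMap_strictMonoOn hn).monotoneOn hx one_mem_Ioc hx.2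

/-- A bounded sequence of remainders certifies an expansion in base `b`. -/
lemma hasSum_of_remainders {b : ℝ} (hb : 1 < b) {a z : ℕ → ℝ} (ha : ∀ i, 0 ≤ a i)
    (hz : ∀ i, z i ∈ Ioc (0 : ℝ) 1) (h : ∀ i, z i = (a i + z (i + 1)) / b) :
    HasSum (fun i => a i / b ^ (i + 1)) (z 0) := by
  have hb0 : 0 < b := by linarith
  rw [hasSum_iff_tendsto_nat_of_nonneg fun i => div_nonneg (ha i) (by positivity)]
  have key : ∀ L, ∑ i ∈ Finset.range L, a i / b ^ (i + 1) = z 0 - z L * (1 / b) ^ L := by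
    intro L
    induction L with
    | zero => simp
    | succ L ih =>
      rw [Finset.sum_range_succ, ih, h L, one_div_pow, one_div_pow, pow_succ]
      field_simp
      ring
  simp only [key]
  have h0 : Tendsto (fun L => z L * (1 / b) ^ L) atTop (𝓝 0) := by
    refine squeeze_zero (fun L => mul_nonneg (hz L).1.le (by positivity))
      (fun L => mul_le_of_le_one_left (by positivity) (hz L).2)
      (tendsto_pow_atTop_nhds_zero_of_lt_one (by positivity) ?_)
    rwa [div_lt_one hb0]
  simpa using h0.const_sub (z 0)

lemma cantorMap_mem_cantor {n : ℕ} (hn : 1 ≤ n) {x : ℝ} (hx : x ∈ Ioc (0 : ℝ) 1) :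
    cantorMap n x ∈ cantor (n + 2) := by
  refine ⟨Ioc_subset_Icc_self (cantorMap_mem hn hx),
    fun i => if dbl^[i] x ≤ 1 / 2 then 0 else ((n + 2 : ℕ) : ℝ) - 1, fun i => ?_, ?_⟩
  · beta_reduce
    split_ifs <;> simp
  · have hmem : ∀ i, dbl^[i] x ∈ Ioc (0 : ℝ) 1 := fun i => by
      induction i with
      | zero => exact hx
      | succ i ih => rw [Function.iterate_succ_apply']; exact dbl_mem ih
    refine hasSum_of_remainders (z := fun i => cantorMap n (dbl^[i] x)) ?_ (fun i => ?_)
      (fun i => cantorMap_mem hn (hmem i)) fun i => ?_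
    · push_cast
      linarith [(n.cast_nonneg : (0 : ℝ) ≤ n)]
    · split_ifs
      · exact le_rfl
      · push_cast
        linarith [(n.cast_nonneg : (0 : ℝ) ≤ n)]
    · rw [Function.iterate_succ_apply']
      obtain ⟨y, hy, h | h⟩ := exists_eq_half (hmem i)
      · rw [h, if_pos (half_le hy), dbl_half hy, cantorMap_half hn hy]
        push_cast
        ring
      · rw [h, if_neg (not_half_add_le hy), dbl_half_add hy, cantorMap_half_add hn hy]
        push_cast
        ring

lemma finite_expansion_bounds {n r : ℕ} {a : ℕ → ℝ}
    (ha : ∀ i, a i = 0 ∨ a i = ((n + 2 : ℕ) : ℝ) - 1) :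
    (∑ i ∈ Finset.range r, a i / ((n + 2 : ℕ) : ℝ) ^ (i + 1)) ∈ Icc (0 : ℝ) 1 := by
  have hb : (0 : ℝ) < ((n + 2 : ℕ) : ℝ) := by positivity
  have h0 : ∀ i, 0 ≤ a i ∧ a i ≤ ((n + 2 : ℕ) : ℝ) - 1 := fun i => by
    have : (0 : ℝ) ≤ ((n + 2 : ℕ) : ℝ) - 1 := by
      push_cast; linarith [(n.cast_nonneg : (0 : ℝ) ≤ n)]
    rcases ha i with h | h <;> rw [h] <;> simp only [le_refl, true_and, and_true] <;> exact this
  refine ⟨Finset.sum_nonneg fun i _ => div_nonneg (h0 i).1 (by positivity), ?_⟩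
  have key : ∑ i ∈ Finset.range r, a i / ((n + 2 : ℕ) : ℝ) ^ (i + 1) ≤
      1 - 1 / ((n + 2 : ℕ) : ℝ) ^ r := by
    induction r with
    | zero => simp
    | succ r ih =>
      rw [Finset.sum_range_succ]
      have : a r / ((n + 2 : ℕ) : ℝ) ^ (r + 1) ≤
          (((n + 2 : ℕ) : ℝ) - 1) / ((n + 2 : ℕ) : ℝ) ^ (r + 1) := by
        gcongr
        exact (h0 r).2
      have e : (((n + 2 : ℕ) : ℝ) - 1) / ((n + 2 : ℕ) : ℝ) ^ (r + 1) =
          1 / ((n + 2 : ℕ) : ℝ) ^ r - 1 / ((n + 2 : ℕ) : ℝ) ^ (r + 1) := by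
        rw [pow_succ]; field_simp
      linarith
  have : (0 : ℝ) ≤ 1 / ((n + 2 : ℕ) : ℝ) ^ r := by positivity
  linarith

/-- The digits of `cantorMap n x` are determined one by one, and infinitely many are nonzero. -/
lemma cantorMap_notMem_cantorB {n : ℕ} (hn : 1 ≤ n) {x : ℝ} (hx : x ∈ Ioc (0 : ℝ) 1) :
    cantorMap n x ∉ cantorB (n + 2) := by
  rintro ⟨-, r, a, ha, h⟩
  have hn' : (1 : ℝ) ≤ n := by exact_mod_cast hn
  have hb : (0 : ℝ) < (n : ℝ) + 2 := by positivity
  induction r generalizing x a with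
  | zero =>
    have := (cantorMap_mem hn hx).1
    rw [h] at this
    simp at this
  | succ r ih =>
    have e : ∑ i ∈ Finset.range (r + 1), a i / ((n + 2 : ℕ) : ℝ) ^ (i + 1) =
        (a 0 + ∑ i ∈ Finset.range r, a (i + 1) / ((n + 2 : ℕ) : ℝ) ^ (i + 1)) / (n + 2) := by
      rw [Finset.sum_range_succ', add_div, Finset.sum_div, add_comm]
      push_cast
      congr 1
      · simp
      · refine Finset.sum_congr rfl fun i _ => ?_
        rw [pow_succ _ (i + 1), div_div]
    have hr := finite_expansion_bounds (r := r) (a := fun i => a (i + 1)) fun i => ha (i + 1)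
    have ih' := fun y (hy : y ∈ Ioc (0 : ℝ) 1) =>
      ih (a := fun i => a (i + 1)) hy fun i => ha (i + 1)
    rw [e] at h
    obtain ⟨y, hy, rfl | rfl⟩ := exists_eq_half hx
    · have hc := cantorMap_mem hn hy
      rw [cantorMap_half hn hy, div_left_inj' hb.ne'] at h
      rcases ha 0 with h0 | h0
      · exact ih' y hy (by rw [h, h0, zero_add])
      · rw [h0] at h
        push_cast at h
        have := hr.1
        push_cast at this
        linarith [hc.2]
    · have hc := cantorMap_mem hn hy
      rw [cantorMap_half_add hn hy, div_left_inj' hb.ne'] at h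
      rcases ha 0 with h0 | h0
      · rw [h0] at h
        linarith [hc.1, hr.2]
      · refine ih' y hy ?_
        rw [h0] at h
        push_cast at h ⊢
        linarith

lemma cantorMap_surjOn {n : ℕ} (hn : 1 ≤ n) :
    SurjOn (cantorMap n) (Ioc 0 1) (cantor (n + 2) \ cantorB (n + 2)) := by
  rintro z ⟨⟨hz, a, ha, hsum⟩, hzB⟩
  have hb1 : (0 : ℝ) ≤ ((n + 2 : ℕ) : ℝ) - 1 := by
    push_cast; linarith [(n.cast_nonneg : (0 : ℝ) ≤ n)]
  -- Otherwise the expansion of `z` is finite.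
  have hinf : ∀ i, ∃ j, a (i + j) ≠ 0 := by
    by_contra! hfin
    obtain ⟨r, hr⟩ := hfin
    refine hzB ⟨hz, r, a, ha, hsum.unique (hasSum_sum_of_ne_finset_zero fun i hi => ?_)⟩
    obtain ⟨j, rfl⟩ := Nat.exists_eq_add_of_le (by simpa using hi : r ≤ i)
    rw [hr j, zero_div]
  set d : ℕ → ℝ := fun i => if a i = 0 then 0 else 1 with hd
  have hd0 : ∀ i, 0 ≤ d i := fun i => by simp only [hd]; split_ifs <;> norm_num
  have hd1 : ∀ i, d i ≤ 1 := fun i => by simp only [hd]; split_ifs <;> norm_num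
  have hgeo : HasSum (fun j : ℕ => 1 / (2 : ℝ) ^ (j + 1)) 1 := by
    simpa [div_eq_mul_inv, pow_succ, mul_comm] using hasSum_geometric_two' 1
  have hs : ∀ i, Summable fun j => d (i + j) / (2 : ℝ) ^ (j + 1) := fun i =>
    hgeo.summable.of_nonneg_of_le (fun j => div_nonneg (hd0 _) (by positivity))
      fun j => div_le_div_of_nonneg_right (hd1 _) (by positivity)
  -- The points with the binary expansions obtained from the tails of the expansion of `z`.
  set x : ℕ → ℝ := fun i => ∑' j, d (i + j) / (2 : ℝ) ^ (j + 1) with hx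
  have hxmem : ∀ i, x i ∈ Ioc (0 : ℝ) 1 := fun i => by
    obtain ⟨j, hj⟩ := hinf i
    constructor
    · refine (hs i).tsum_pos (fun j => div_nonneg (hd0 _) (by positivity)) j ?_
      simp [hd, hj]
    · rw [← hgeo.tsum_eq]
      exact (hs i).tsum_le_tsum (fun j => div_le_div_of_nonneg_right (hd1 _) (by positivity))
        hgeo.summable
  have hxrec : ∀ i, x i = (d i + x (i + 1)) / 2 := fun i => by
    simp only [hx]
    rw [(hs i).tsum_eq_zero_add, add_div, ← tsum_div_const]
    congr 1
    · simp
    · refine tsum_congr fun j => ?_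
      rw [pow_succ _ (j + 1), div_div, show i + (j + 1) = i + 1 + j by omega]
  refine ⟨x 0, hxmem 0, HasSum.unique ?_ hsum⟩
  refine hasSum_of_remainders (z := fun i => cantorMap n (x i)) ?_ (fun i => ?_)
    (fun i => cantorMap_mem hn (hxmem i)) fun i => ?_
  · push_cast
    linarith [(n.cast_nonneg : (0 : ℝ) ≤ n)]
  · rcases ha i with h | h <;> rw [h]
    exact hb1
  · rw [hxrec i]
    rcases ha i with h | h
    · simp only [hd, h, if_true, zero_add]
      rw [cantorMap_half hn (hxmem _)]
      push_cast
      rfl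
    · have hne : a i ≠ 0 := by
        rw [h]; push_cast
        linarith [(n.cast_nonneg : (0 : ℝ) ≤ n)]
      simp only [hd, hne, if_false]
      rw [cantorMap_half_add hn (hxmem _), h]
      push_cast
      ring

lemma cantorMap_bijOn {n : ℕ} (hn : 1 ≤ n) :
    BijOn (cantorMap n) (Ioc 0 1) (cantor (n + 2) \ cantorB (n + 2)) :=
  ⟨fun _ hx => ⟨cantorMap_mem_cantor hn hx, cantorMap_notMem_cantorB hn hx⟩,
    (cantorMap_strictMonoOn hn).injOn, cantorMap_surjOn hn⟩

lemma cantorB_subset_cantor (m : ℕ) : cantorB m ⊆ cantor m := by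
  rintro x ⟨hx, r, a, ha, h⟩
  refine ⟨hx, fun i => if i < r then a i else 0, fun i => ?_, ?_⟩
  · beta_reduce
    split_ifs
    · exact ha i
    · exact Or.inl rfl
  · have : x = ∑ i ∈ Finset.range r, (if i < r then a i else 0) / (m : ℝ) ^ (i + 1) := by
      rw [h]
      exact Finset.sum_congr rfl fun i hi => by rw [if_pos (Finset.mem_range.1 hi)]
    rw [this]
    refine hasSum_sum_of_ne_finset_zero fun i hi => ?_
    have : ¬ i < r := by simpa using hi
    simp [this]

lemma countable_cantorB (n : ℕ) : (cantorB (n + 2)).Countable := by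
  refine (countable_range fun p : ℕ × ℕ => (p.1 : ℝ) / ((n + 2 : ℕ) : ℝ) ^ p.2).mono ?_
  rintro x ⟨-, r, a, ha, rfl⟩
  induction r with
  | zero => exact ⟨(0, 0), by simp⟩
  | succ r ih =>
    obtain ⟨⟨p, q⟩, hp⟩ := ih
    have hb : ((n + 2 : ℕ) : ℝ) ≠ 0 := by positivity
    obtain ⟨c, hc⟩ : ∃ c : ℕ, a r = c := by
      rcases ha r with h | h
      · exact ⟨0, by simp [h]⟩
      · exact ⟨n + 1, by rw [h]; push_cast; ring⟩
    refine ⟨(p * (n + 2) ^ (r + 1) + c * (n + 2) ^ q, q + (r + 1)), ?_⟩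
    rw [Finset.sum_range_succ, ← hp, hc]
    dsimp only
    rw [div_add_div _ _ (pow_ne_zero _ hb) (pow_ne_zero _ hb), ← pow_add]
    push_cast
    ring

/-! ### The Hausdorff dimension of the Cantor set -/

/-- The inverse of the Cantor map is Hölder continuous of exponent `log 2 / log (n + 2)`. -/
lemma cantorMap_sub_ge {n : ℕ} (hn : 1 ≤ n) {t : ℝ} (ht : (2 : ℝ) ^ t = n + 2) {x y : ℝ}
    (hx : x ∈ Ioc (0 : ℝ) 1) (hy : y ∈ Ioc (0 : ℝ) 1) (hxy : x < y) :
    n / ((n : ℝ) + 2) * (y - x) ^ t ≤ cantorMap n y - cantorMap n x := by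
  have hb : (0 : ℝ) < (n : ℝ) + 2 := by positivity
  have ht0 : 0 ≤ t := by
    by_contra! h
    have := Real.rpow_le_one_of_one_le_of_nonpos (one_le_two (α := ℝ)) h.le
    rw [ht] at this
    linarith [(n.cast_nonneg : (0 : ℝ) ≤ n)]
  have hscale : ∀ x y : ℝ, x < y → (y / 2 - x / 2) ^ t = (y - x) ^ t / (n + 2) := by
    intro x y h
    rw [← sub_div, Real.div_rpow (by linarith) two_pos.le, ht]
  refine digit_induction (p := fun x y =>
    n / ((n : ℝ) + 2) * (y - x) ^ t ≤ cantorMap n y - cantorMap n x) ?_ ?_ ?_ hx hy hxy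
  · intro x hx y hy h ih
    rw [hscale x y h, cantorMap_half hn hx, cantorMap_half hn hy, ← sub_div, ← mul_div_assoc]
    exact div_le_div_of_nonneg_right ih hb.le
  · intro x hx y hy h ih
    rw [hscale (1 + x) (1 + y) (by linarith), cantorMap_half_add hn hx, cantorMap_half_add hn hy,
      ← sub_div, ← mul_div_assoc, add_sub_add_left_eq_sub, add_sub_add_left_eq_sub]
    exact div_le_div_of_nonneg_right ih hb.le
  · intro x hx y hy
    have h1 := (cantorMap_mem hn hy).1
    have h2 := (cantorMap_mem hn hx).2
    rw [cantorMap_half hn hx, cantorMap_half_add hn hy,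
      ← sub_div _ _ ((n : ℝ) + 2)]
    calc n / ((n : ℝ) + 2) * ((1 + y) / 2 - x / 2) ^ t ≤ n / ((n : ℝ) + 2) * 1 := by
          gcongr
          exact Real.rpow_le_one (by linarith [hx.2, hy.1]) (by linarith [hx.1, hy.2]) ht0
      _ ≤ _ := by
          rw [mul_one]
          gcongr
          linarith

/-- The image of the Cantor map is covered by `2 ^ L` intervals of length `(n + 2)⁻¹ ^ L`. -/
lemma exists_cover {n : ℕ} (hn : 1 ≤ n) (L : ℕ) : ∃ S : Finset ℝ, S.card ≤ 2 ^ L ∧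
    ∀ x ∈ Ioc (0 : ℝ) 1, ∃ s ∈ S, cantorMap n x ∈ Icc s (s + (1 / ((n : ℝ) + 2)) ^ L) := by
  have hb : (0 : ℝ) < (n : ℝ) + 2 := by positivity
  induction L with
  | zero =>
    refine ⟨{0}, by simp, fun x hx => ⟨0, by simp, ?_⟩⟩
    simpa using Ioc_subset_Icc_self (cantorMap_mem hn hx)
  | succ L ih =>
    obtain ⟨S, hS, hcov⟩ := ih
    classical
    refine ⟨S.image (fun s => s / ((n : ℝ) + 2)) ∪ S.image (fun s => (n + 1 + s) / ((n : ℝ) + 2)),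
      ?_, fun x hx => ?_⟩
    · refine (Finset.card_union_le _ _).trans ?_
      rw [pow_succ, mul_two]
      exact add_le_add (Finset.card_image_le.trans hS) (Finset.card_image_le.trans hS)
    · obtain ⟨y, hy, rfl | rfl⟩ := exists_eq_half hx <;> obtain ⟨s, hs, h1, h2⟩ := hcov y hy
      · refine ⟨s / (n + 2), Finset.mem_union_left _ (Finset.mem_image_of_mem _ hs), ?_, ?_⟩
        · rw [cantorMap_half hn hy]
          gcongr
        · rw [cantorMap_half hn hy, pow_succ, mul_one_div, ← add_div]
          gcongr
      · refine ⟨(n + 1 + s) / (n + 2), Finset.mem_union_right _ (Finset.mem_image_of_mem _ hs),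
          ?_, ?_⟩
        · rw [cantorMap_half_add hn hy]
          gcongr
        · rw [cantorMap_half_add hn hy, pow_succ, mul_one_div, ← add_div, add_assoc _ s]
          gcongr

lemma dimH_cantorMap_le {n : ℕ} (hn : 1 ≤ n) {s : ℝ} (hs : ((n : ℝ) + 2) ^ s = 2) (hs0 : 0 < s) :
    dimH (cantorMap n '' Ioc 0 1) ≤ ENNReal.ofReal s := by
  have hb : (1 : ℝ) < (n : ℝ) + 2 := by linarith [(n.cast_nonneg : (0 : ℝ) ≤ n)]
  have hb0 : (0 : ℝ) < (n : ℝ) + 2 := by positivity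
  choose S hS hcov using fun L => exists_cover hn L
  refine dimH_le_of_hausdorffMeasure_ne_top (ne_top_of_le_ne_top ENNReal.one_ne_top ?_)
  rw [Real.coe_toNNReal s hs0.le]
  have hr : Tendsto (fun L : ℕ => ENNReal.ofReal ((1 / ((n : ℝ) + 2)) ^ L)) atTop (𝓝 0) := by
    rw [← ENNReal.ofReal_zero]
    refine ENNReal.tendsto_ofReal (tendsto_pow_atTop_nhds_zero_of_lt_one (by positivity) ?_)
    rwa [div_lt_one hb0]
  have hdiam : ∀ (L : ℕ) (i : S L), Metric.ediam (Icc (i : ℝ) (i + (1 / ((n : ℝ) + 2)) ^ L)) =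
      ENNReal.ofReal ((1 / ((n : ℝ) + 2)) ^ L) := fun L i => by
    rw [Real.ediam_Icc, add_sub_cancel_left]
  refine (Measure.hausdorffMeasure_le_liminf_sum s _ _ hr
    (fun L (i : S L) => Icc (i : ℝ) (i + (1 / ((n : ℝ) + 2)) ^ L))
    (Eventually.of_forall fun L i => (hdiam L i).le) (Eventually.of_forall fun L => ?_)).trans ?_
  · rintro _ ⟨x, hx, rfl⟩
    obtain ⟨i, hi, h⟩ := hcov L x hx
    exact mem_iUnion.2 ⟨⟨i, hi⟩, h⟩
  · refine (liminf_le_liminf (v := fun _ => (1 : ENNReal))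
      (Eventually.of_forall fun L => ?_)).trans_eq (liminf_const _)
    have e : ((1 / ((n : ℝ) + 2)) ^ L) ^ s = 1 / 2 ^ L := by
      rw [← Real.rpow_natCast, ← Real.rpow_mul (by positivity), mul_comm, Real.rpow_mul
        (by positivity), Real.div_rpow zero_le_one hb0.le, hs, Real.one_rpow, Real.rpow_natCast,
        one_div_pow]
    simp only [hdiam, Finset.sum_const, nsmul_eq_mul, Finset.card_univ, Fintype.card_coe]
    rw [ENNReal.ofReal_rpow_of_pos (by positivity), e]
    calc ((S L).card : ENNReal) * ENNReal.ofReal (1 / 2 ^ L)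
        ≤ ((2 ^ L : ℕ) : ENNReal) * ENNReal.ofReal (1 / 2 ^ L) := by
          gcongr
          exact hS L
      _ = 1 := by
          rw [← ENNReal.ofReal_natCast, ← ENNReal.ofReal_mul (by positivity)]
          push_cast
          rw [mul_one_div_cancel (by positivity), ENNReal.ofReal_one]

lemma le_dimH_cantorMap {n : ℕ} (hn : 1 ≤ n) {s : ℝ} (hs : ((n : ℝ) + 2) ^ s = 2) (hs0 : 0 < s) :
    ENNReal.ofReal s ≤ dimH (cantorMap n '' Ioc 0 1) := by
  have hn' : (0 : ℝ) < n := by exact_mod_cast hn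
  have hb0 : (0 : ℝ) < (n : ℝ) + 2 := by positivity
  have ht : (2 : ℝ) ^ s⁻¹ = n + 2 := by
    conv_lhs => rw [← hs]
    rw [← Real.rpow_mul hb0.le, mul_inv_cancel₀ hs0.ne', Real.rpow_one]
  set κ := (n : ℝ) / (n + 2) with hκ
  have hκ0 : 0 < κ := by positivity
  set g := Function.invFunOn (cantorMap n) (Ioc 0 1)
  have hg : ∀ x ∈ Ioc (0 : ℝ) 1, g (cantorMap n x) = x :=
    fun x hx => (cantorMap_strictMonoOn hn).injOn.leftInvOn_invFunOn hx
  have hlt : ∀ x ∈ Ioc (0 : ℝ) 1, ∀ y ∈ Ioc (0 : ℝ) 1, x < y →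
      y - x ≤ κ⁻¹ ^ s * (cantorMap n y - cantorMap n x) ^ s := by
    intro x hx y hy hxy
    have h1 := cantorMap_sub_ge hn ht hx hy hxy
    have h2 : 0 ≤ cantorMap n y - cantorMap n x :=
      sub_nonneg.2 ((cantorMap_strictMonoOn hn).monotoneOn hx hy hxy.le)
    have h3 : (y - x) ^ s⁻¹ ≤ κ⁻¹ * (cantorMap n y - cantorMap n x) := by
      rw [inv_mul_eq_div, le_div_iff₀ hκ0, mul_comm]
      exact h1
    have h4 := Real.rpow_le_rpow (Real.rpow_nonneg (sub_nonneg.2 hxy.le) _) h3 hs0.le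
    rwa [← Real.rpow_mul (sub_nonneg.2 hxy.le), inv_mul_cancel₀ hs0.ne', Real.rpow_one,
      Real.mul_rpow (by positivity) h2] at h4
  have hholder : HolderOnWith (κ⁻¹ ^ s).toNNReal s.toNNReal g (cantorMap n '' Ioc 0 1) := by
    rintro _ ⟨x, hx, rfl⟩ _ ⟨y, hy, rfl⟩
    rw [hg x hx, hg y hy, edist_dist, edist_dist, Real.coe_toNNReal s hs0.le,
      ENNReal.ofReal_rpow_of_nonneg dist_nonneg hs0.le]
    refine (ENNReal.ofReal_le_ofReal ?_).trans_eq (ENNReal.ofReal_mul (by positivity))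
    rcases lt_trichotomy x y with h | rfl | h
    · have h2 := (cantorMap_strictMonoOn hn) hx hy h
      rw [dist_comm x, dist_comm (cantorMap n x), Real.dist_eq, Real.dist_eq,
        abs_of_pos (sub_pos.2 h), abs_of_pos (sub_pos.2 h2)]
      exact hlt x hx y hy h
    · simp [Real.zero_rpow hs0.ne']
    · have h2 := (cantorMap_strictMonoOn hn) hy hx h
      rw [Real.dist_eq, Real.dist_eq, abs_of_pos (sub_pos.2 h), abs_of_pos (sub_pos.2 h2)]
      exact hlt y hy x hx h
  have himg : g '' (cantorMap n '' Ioc 0 1) = Ioc 0 1 := by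
    rw [image_image]
    exact (image_congr hg).trans (image_id' _)
  have h1 := hholder.dimH_image_le (Real.toNNReal_pos.2 hs0)
  rw [himg, Real.dimH_of_nonempty_interior (by rw [interior_Ioc]; exact ⟨1 / 2, by norm_num⟩),
    Module.finrank_self, Nat.cast_one] at h1
  have h2 : ENNReal.ofReal s ≠ 0 := by simpa using hs0
  simpa using (ENNReal.le_div_iff_mul_le (Or.inl h2) (Or.inl ENNReal.ofReal_ne_top)).1 h1

lemma dimH_cantor_diff {n : ℕ} (hn : 1 ≤ n) :
    dimH (cantor (n + 2) \ cantorB (n + 2)) =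
      ENNReal.ofReal (Real.log 2 / Real.log ((n : ℝ) + 2)) := by
  have hb : (1 : ℝ) < (n : ℝ) + 2 := by linarith [(n.cast_nonneg : (0 : ℝ) ≤ n)]
  have hs0 : 0 < Real.log 2 / Real.log ((n : ℝ) + 2) :=
    div_pos (Real.log_pos one_lt_two) (Real.log_pos hb)
  have hs : ((n : ℝ) + 2) ^ (Real.log 2 / Real.log ((n : ℝ) + 2)) = 2 := by
    rw [Real.rpow_def_of_pos (by linarith), mul_div_cancel₀ _ (Real.log_pos hb).ne',
      Real.exp_log two_pos]
  rw [← (cantorMap_bijOn hn).image_eq]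
  exact le_antisymm (dimH_cantorMap_le hn hs hs0) (le_dimH_cantorMap hn hs hs0)

lemma BiLipschitzEquivalent.dimH_eq {A B : Set ℝ} (h : BiLipschitzEquivalent A B) :
    dimH A = dimH B := by
  obtain ⟨f, hf, c, C, hc, hC, hb⟩ := h
  apply le_antisymm
  · have hg := hf.invOn_invFunOn.1
    have hlip : LipschitzOnWith c⁻¹.toNNReal (Function.invFunOn f A) B := by
      rw [← hf.image_eq]
      refine LipschitzOnWith.of_dist_le_mul ?_
      rintro _ ⟨x, hx, rfl⟩ _ ⟨y, hy, rfl⟩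
      rw [hg hx, hg hy, Real.dist_eq, Real.dist_eq, Real.coe_toNNReal _ (by positivity),
        inv_mul_eq_div, le_div_iff₀ hc, mul_comm]
      exact (hb x hx y hy).1
    have himg : Function.invFunOn f A '' B = A := by
      rw [← hf.image_eq]
      exact hg.image_image
    have := hlip.dimH_image_le
    rwa [himg] at this
  · have hlip : LipschitzOnWith C.toNNReal f A := by
      refine LipschitzOnWith.of_dist_le_mul fun x hx y hy => ?_
      rw [Real.dist_eq, Real.dist_eq, Real.coe_toNNReal _ hC.le]
      exact (hb x hx y hy).2
    have := hlip.dimH_image_le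
    rwa [hf.image_eq] at this

/-! ### The jump part -/

lemma isJumpFunctionOn_sumBelow {f : List Bool → ℝ} (hf : Summable f) (h0 : ∀ u, 0 < f u) (c : ℝ)
    (I : Set ℝ) : IsJumpFunctionOn (fun x => c + sumBelow f x) I (range dyad) := by
  have hinv : ∀ u, Function.invFun dyad (dyad u) = u := Function.leftInverse_invFun dyad_injective
  refine ⟨c, fun y => f (Function.invFun dyad y), fun y _ => h0 _, ?_, fun x _ => ?_⟩
  · rw [← (Equiv.ofInjective dyad dyad_injective).summable_iff]
    refine hf.congr fun u => ?_
    simp [hinv]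
  · refine congrArg (c + ·) ?_
    have h1 := tsum_subtype {y : ℝ | y ∈ range dyad ∧ y < x} fun y => f (Function.invFun dyad y)
    refine Eq.trans ?_ h1.symm
    rw [← dyad_injective.tsum_eq]
    · refine tsum_congr fun u => ?_
      by_cases h : dyad u < x <;> simp [indicator, h, hinv]
    · intro y hy
      exact (mem_of_indicator_ne_zero hy).1

/-- The jumps of `H` and of `cantorMap n` sit at the same points, and their ratio is bounded above
and below. -/
lemma biLipschitzEquivalent_jump {n : ℕ} (hn : 1 ≤ n) (c : ℝ) :
    BiLipschitzEquivalent ((fun x => c + sumBelow (jump n) x) '' Ioc 0 1)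
      (cantor (n + 2) \ cantorB (n + 2)) := by
  set H := fun x => c + sumBelow (jump n) x with hH
  set I := Ioc (0 : ℝ) 1
  set E := sumBelow fun u => (1 / ((n : ℝ) + 2)) ^ u.length with hE
  set a := jumpVec n (n + 2)
  set b := ∑' m, eig n (n + 2) m
  set κ := (n : ℝ) / (n + 2) with hκ
  have hn' : (0 : ℝ) < n := by exact_mod_cast hn
  have hκ0 : 0 < κ := by positivity
  have ha : 0 < a := jumpVec_first_pos hn
  have hb : 0 < b := by
    refine (summable_eig n (n + 2)).tsum_pos (eig_nonneg _ _) (n + 2) ?_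
    rw [eig_self]
    exact one_pos
  have hinj : InjOn H I := by
    intro x hx y hy h
    exact (sumBelow_strictMonoOn (summable_jump hn) (jump_pos hn)).injOn hx hy (add_left_cancel h)
  have hl : ∀ x ∈ I, Function.invFunOn H I (H x) = x := fun x hx => hinj.leftInvOn_invFunOn hx
  have hr := summable_ratio_pow hn
  have hord : ∀ x ∈ I, ∀ y ∈ I, x ≤ y →
      κ / b * |H x - H y| ≤ |cantorMap n x - cantorMap n y| ∧
        |cantorMap n x - cantorMap n y| ≤ κ / a * |H x - H y| := by
    intro x hx y hy hxy
    have h1 := sumBelow_sub_le (hr.mul_left a) (summable_jump hn) (fun u => by positivity)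
      (le_jump hn) hxy
    have h2 := sumBelow_sub_le (summable_jump hn) (hr.mul_left b) (fun u => (jump_pos hn u).le)
      (jump_le hn) hxy
    simp only [sumBelow_const_mul, ← hE, ← mul_sub] at h1 h2
    have h3 : 0 ≤ H y - H x := by
      rw [add_sub_add_left_eq_sub]
      exact sub_nonneg.2 ((sumBelow_strictMonoOn (summable_jump hn) (jump_pos hn)).monotoneOn
        hx hy hxy)
    have h4 : 0 ≤ cantorMap n y - cantorMap n x :=
      sub_nonneg.2 ((cantorMap_strictMonoOn hn).monotoneOn hx hy hxy)
    have h5 : cantorMap n y - cantorMap n x = κ * (E y - E x) := by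
      rw [mul_sub]
      rfl
    have h6 : H y - H x = sumBelow (jump n) y - sumBelow (jump n) x := add_sub_add_left_eq_sub _ _ _
    rw [abs_sub_comm, abs_of_nonneg h3, abs_sub_comm, abs_of_nonneg h4, h5, h6]
    constructor
    · rw [div_mul_eq_mul_div κ b, div_le_iff₀ hb, mul_assoc, mul_comm (E y - E x)]
      exact mul_le_mul_of_nonneg_left h2 hκ0.le
    · rw [div_mul_eq_mul_div κ a, le_div_iff₀ ha, mul_assoc, mul_comm (E y - E x)]
      exact mul_le_mul_of_nonneg_left h1 hκ0.le
  refine ⟨cantorMap n ∘ Function.invFunOn H I, ?_, κ / b, κ / a, by positivity, by positivity, ?_⟩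
  · refine (cantorMap_bijOn hn).comp ⟨?_, ?_, ?_⟩
    · rintro _ ⟨x, hx, rfl⟩
      rwa [hl x hx]
    · rintro _ ⟨x, hx, rfl⟩ _ ⟨y, hy, rfl⟩ h
      rw [hl x hx, hl y hy] at h
      rw [h]
    · exact fun x hx => ⟨H x, mem_image_of_mem H hx, hl x hx⟩
  · rintro _ ⟨x, hx, rfl⟩ _ ⟨y, hy, rfl⟩
    simp only [Function.comp_apply, hl x hx, hl y hy]
    rcases le_total x y with h | h
    · exact hord x hx y hy h
    · rw [abs_sub_comm (H x), abs_sub_comm (cantorMap n x)]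
      exact hord y hy x hx h

/-! ### The decomposition -/

/-- The increments of `g - h` are bounded by those of the monotone function `g + h`. -/
lemma boundedVariationOn_sub_of_monotoneOn {g h : ℝ → ℝ} {s : Set ℝ} {C : ℝ}
    (hg : MonotoneOn g s) (hh : MonotoneOn h s) (hC : ∀ x ∈ s, |g x + h x| ≤ C) :
    BoundedVariationOn (fun x => g x - h x) s := by
  refine ne_top_of_le_ne_top ((hg.add hh).boundedVariationOn hC)
    (iSup_mono fun p => Finset.sum_le_sum fun i _ => ?_)
  have h1 := hg (p.2.2.2 i) (p.2.2.2 (i + 1)) (p.2.2.1 i.le_succ)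
  have h2 := hh (p.2.2.2 i) (p.2.2.2 (i + 1)) (p.2.2.1 i.le_succ)
  rw [edist_dist, edist_dist]
  refine ENNReal.ofReal_le_ofReal ?_
  rw [Real.dist_eq, Real.dist_eq]
  refine le_trans ?_ (le_abs_self _)
  rw [abs_le]
  constructor <;> linarith

end ZetaStarDeformation

end

theorem theorem1p2 (n : ℕ) (hn : 1 ≤ n) :
    -- `F n` is well defined: `τ` is a bijection onto `(0, 1]` and the limits `η_n` exist
    Set.BijOn tau Set.univ (Set.Ioc 0 1) ∧
    (∀ k : PosSeq, Tendsto (fun r => T n k r) atTop (𝓝 (eta n k))) ∧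
    Set.MapsTo (F n) (Set.Ioc 0 1) (Set.Ioi 1) ∧
    -- `τ(T^R)` is the set of dyadic rationals in `(0, 1)`
    tau '' SeqR = {x : ℝ | x ∈ Set.Ioo (0 : ℝ) 1 ∧ ∃ l m : ℕ, (2 : ℝ) ^ l * x = m} ∧
    BoundedVariationOn (F n) (Set.Ioc 0 1) ∧
    ∃ G H : ℝ → ℝ,
      (∀ x ∈ Set.Ioc (0 : ℝ) 1, F n x = G x - H x) ∧
      Set.MapsTo G (Set.Ioc 0 1) (Set.Ioi 1) ∧
      Set.MapsTo H (Set.Ioc 0 1) (Set.Ioi 1) ∧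
      StrictMonoOn G (Set.Ioc 0 1) ∧
      StrictMonoOn H (Set.Ioc 0 1) ∧
      ContinuousOn G (Set.Ioc 0 1) ∧
      (∀ x ∈ tau '' SeqR, ¬ ContinuousWithinAt H (Set.Ioc 0 1) x) ∧
      (∀ x ∈ tau '' SeqRᶜ, ContinuousWithinAt H (Set.Ioc 0 1) x) ∧
      IsJumpFunctionOn H (Set.Ioc 0 1) (tau '' SeqR) ∧
      cantorB (n + 2) ⊆ cantor (n + 2) ∧
      (cantorB (n + 2)).Countable ∧
      BiLipschitzEquivalent (H '' Set.Ioc 0 1) (cantor (n + 2) \ cantorB (n + 2)) ∧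
      dimH (H '' Set.Ioc 0 1) = ENNReal.ofReal (Real.log 2 / Real.log ((n : ℝ) + 2)) := by
  have hG := contPart_strictMonoOn hn
  have hJ := sumBelow_strictMonoOn (summable_jump hn) (jump_pos hn)
  have hJ0 : ∀ u, 0 ≤ jump n u := fun u => (jump_pos hn u).le
  have hF : ∀ x ∈ Set.Ioc (0 : ℝ) 1,
      F n x = (2 + contPart n x) - (1 + sumBelow (jump n) x) := fun x hx => by
    rw [F_eq n hx, tsum_limVec_eq hn]
    ring
  have hBL := biLipschitzEquivalent_jump hn 1
  refine ⟨tau_bijOn, fun k => ?_, fun x hx => ?_, tau_image_seqR.trans range_dyad, ?_,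
    fun x => 2 + contPart n x, fun x => 1 + sumBelow (jump n) x, hF, fun x _ => ?_, fun x hx => ?_,
    fun x hx y hy h => add_lt_add_right (hG hx hy h) 2,
    fun x hx y hy h => add_lt_add_right (hJ hx hy h) 1,
    continuousOn_const.add (continuousOn_contPart hn), ?_, ?_, ?_,
    cantorB_subset_cantor _, countable_cantorB n, hBL, hBL.dimH_eq.trans (dimH_cantor_diff hn)⟩
  · rw [eta_eq]
    exact tendsto_T n k
  · rw [Set.mem_Ioi, F_eq n hx]
    exact one_lt_tsum_limVec hn hx
  · have hbv := boundedVariationOn_sub_of_monotoneOn (s := Set.Ioc 0 1)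
      (C := 2 + contPart n 1 + (1 + sumBelow (jump n) 1))
      (hG.monotoneOn.const_add 2) (hJ.monotoneOn.const_add 1) fun x _ => by
        have h1 := contPart_nonneg n x
        have h2 := sumBelow_nonneg hJ0 x
        rw [abs_of_nonneg (by linarith)]
        linarith [contPart_le_one hn x, sumBelow_le_one (summable_jump hn) hJ0 x]
    unfold BoundedVariationOn at hbv ⊢
    rwa [eVariationOn.congr hF]
  · have := contPart_nonneg n x
    simp only [Set.mem_Ioi]
    linarith
  · have := sumBelow_pos (summable_jump hn) (jump_pos hn) hx
    simp only [Set.mem_Ioi]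
    linarith
  · rw [tau_image_seqR]
    rintro _ ⟨u, rfl⟩ h
    refine not_continuousWithinAt_sumBelow (summable_jump hn) (jump_pos hn) u ?_
    exact (h.sub (continuousWithinAt_const (b := (1 : ℝ)))).congr (fun y _ => by simp) (by simp)
  · rintro _ ⟨k, hk, rfl⟩
    exact (continuousAt_const.add (continuousAt_sumBelow (summable_jump hn) hJ0
      fun h => hk (mem_seqR_of_tau h))).continuousWithinAt
  · rw [tau_image_seqR]
    exact isJumpFunctionOn_sumBelow (summable_jump hn) (jump_pos hn) 1 _
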